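/- **Setting.** Let $(X,\mu)$ be a standard probability space. Let $\mathcal G$ be a *discrete measured groupoid* on $(X,\mu)$: a groupoid with unit space $X$, range and source maps $r,s\colon\mathcal G\to X$ and units $e_x$ $(x\in X)$, equipped with a standard Borel structure for which $r$, $s$, the inverse map and the product map are Borel, such that $\mathcal G^y=r^{-1}(y)$ is countable for every $y\in X$, and such that $\mu$ is quasi-invariant, i.e. the measure $\tilde\mu(E)=\int_X|E\cap\mathcal G_x|\,d\mu(x)$ on $\mathcal G$, where $\mathcal G_x=s^{-1}(x)$, is equivalent to its image under $g\mapsto g^{-1}$. "Measurable" means measurable up to null sets, "a.e. $g\in\mathcal G$" refers to $\tilde\mu$, and "a.e. $(g,h)\in\mathcal G^{(2)}=\{(g,h)\mid s(g)=r(h)\}$" refers to the measure $E\mapsto\int_X|\{(g,h)\in E\mid s(h)=x\}|\,d\mu(x)$. A *subgroupoid* of $\mathcal G$ is a measurable subset containing all units and closed under products and inverses; it is regarded as a groupoid on $(X,\mu)$ in its own right. Discrete groups are countable. A *homomorphism* from $\mathcal G$ to a discrete group $A$ is a measurable map $\alpha\colon\mathcal G\to A$ with $\alpha(gh)=\alpha(g)\alpha(h)$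 for a.e. $(g,h)\in\mathcal G^{(2)}$; its kernel is $\ker\alpha=\{g\in\mathcal G\mid\alpha(g)=1\}$. It is *class-surjective* if $\alpha(\mathcal G_x)=A$ for a.e. $x\in X$. A discrete group $A$ is *amenable* if it has a sequence of non-empty finite subsets $F_n$ with $|gF_n\bigtriangleup F_n|/|F_n|\to0$ for every $g\in A$. **Haagerup property.** $\mathcal G$ has the *Haagerup property (HAP)* if there is a sequence $(\phi_n)_n$ of measurable functions $\phi_n\colon\mathcal G\to\mathbb C$ with $\phi_n(g)\to1$ for a.e. $g\in\mathcal G$, such that each $\phi=\phi_n$ is - *positive definite*: for a.e. $x\in X$, all $g_1,\dots,g_k\in\mathcal G^x$ and all $\lambda_1,\dots,\lambda_k\in\mathbb C$, $\sum_{i,j}\overline{\lambda_i}\lambda_j\,\phi(g_i^{-1}g_j)\ge0$; - *normalized*: $\phi(e_x)=1$ for a.e. $x\in X$; - *$c_0$*: for all $\delta,\varepsilon>0$ there is a measurable $Y\subset X$ with $\mu(X\setminus Y)<\delta$ such that for a.e. $x\in Y$ the set $\{g\in\mathcal G\mid s(g)=x,\ r(g)\in Y,\ |\phi(g)|>\varepsilon\}$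 is finite. The same definition applies to subgroupoids of $\mathcal G$. **Proposition.** Let $\mathcal S$ be a subgroupoid of $\mathcal G$. Suppose that there exist an amenable discrete group $A$ and a homomorphism $\alpha\colon\mathcal G\to A$ such that $\ker\alpha=\mathcal S$ up to a $\tilde\mu$-null set and such that either $A$ is abelian or $\alpha$ is class-surjective. If $\mathcal S$ has the HAP, then so does $\mathcal G$. -/

import Mathlib

open MeasureTheory Filter Topology
open scoped ComplexOrder

/-- A groupoid `G` on the unit space `X` (purely algebraic data): range and source maps, units,
inverses, and a product `g h` which is defined exactly for the pairs with `s g = r h`. -/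
structure GroupoidOn (X G : Type*) where
  r : G → X
  s : G → X
  unit : X → G
  inv : G → G
  mul : ∀ g h : G, s g = r h → G
  r_unit : ∀ x, r (unit x) = x
  s_unit : ∀ x, s (unit x) = x
  r_inv : ∀ g, r (inv g) = s g
  s_inv : ∀ g, s (inv g) = r g
  r_mul : ∀ g h (e : s g = r h), r (mul g h e) = r g
  s_mul : ∀ g h (e : s g = r h), s (mul g h e) = s h
  unit_mul : ∀ g, mul (unit (r g)) g (s_unit (r g)) = g
  mul_unit : ∀ g, mul g (unit (s g)) (r_unit (s g)).symm = g
  inv_mul : ∀ g, mul (inv g) g (s_inv g) = unit (s g)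
  mul_inv : ∀ g, mul g (inv g) (r_inv g).symm = unit (r g)
  mul_assoc : ∀ g h k (e₁ : s g = r h) (e₂ : s h = r k),
    mul (mul g h e₁) k ((s_mul g h e₁).trans e₂) = mul g (mul h k e₂) (e₁.trans (r_mul h k e₂).symm)

/-- For a map `p : Z → X` with countable fibres, the measure `E ↦ ∫ |E ∩ p⁻¹(x)| dμ(x)` on `Z`:
the integral over `μ` of the counting measures of the fibres of `p`. -/
noncomputable def fiberCountingMeasure {X Z : Type*} [MeasurableSpace X] [MeasurableSpace Z]
    (μ : Measure X) (p : Z → X) : Measure Z :=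
  μ.bind fun x => Measure.count.restrict (p ⁻¹' {x})

/-- Whenever the counting measures of the fibres form a measurable family, which is the case for a
countable-to-one Borel map between standard Borel spaces, `fiberCountingMeasure` is given on
measurable sets by the formula defining it. -/
theorem fiberCountingMeasure_apply {X Z : Type*} [MeasurableSpace X] [MeasurableSpace Z]
    (μ : Measure X) (p : Z → X) (hp : ∀ x, MeasurableSet (p ⁻¹' {x}))
    (h : AEMeasurable (fun x => (Measure.count : Measure Z).restrict (p ⁻¹' {x})) μ)
    {E : Set Z} (hE : MeasurableSet E) :
    fiberCountingMeasure μ p E = ∫⁻ x, ((E ∩ p ⁻¹' {x}).encard : ENNReal) ∂μ := by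
  rw [fiberCountingMeasure, Measure.bind_apply hE h]
  refine lintegral_congr fun x => ?_
  rw [Measure.restrict_apply hE, Measure.count_apply (hE.inter (hp x))]

namespace GroupoidOn

variable {X G : Type*}

/-- The set `G⁽²⁾` of composable pairs. -/
abbrev Composable (𝒢 : GroupoidOn X G) : Type _ := {p : G × G // 𝒢.s p.1 = 𝒢.r p.2}

section Measure

variable [MeasurableSpace X] [MeasurableSpace G]

/-- The measure `μ̃(E) = ∫ |E ∩ Gₓ| dμ(x)` on `G`, where `Gₓ = s⁻¹(x)`. -/
noncomputable def arrowMeasure (𝒢 : GroupoidOn X G) (μ : Measure X) : Measure G :=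
  fiberCountingMeasure μ 𝒢.s

/-- The measure `E ↦ ∫ |E ∩ s₂⁻¹(x)| dμ(x)` on `G⁽²⁾`, where `s₂(g, h) = s(h)`. -/
noncomputable def composableMeasure (𝒢 : GroupoidOn X G) (μ : Measure X) :
    Measure 𝒢.Composable :=
  fiberCountingMeasure μ fun p => 𝒢.s p.1.2

/-- `𝒢` is a discrete measured groupoid on `(X, μ)`: it is Borel and discrete, and `μ` is
quasi-invariant, i.e. `μ̃` is equivalent to its image under the inverse map. -/
structure IsDiscreteMeasured [StandardBorelSpace X] [StandardBorelSpace G]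
    (𝒢 : GroupoidOn X G) (μ : Measure X) : Prop where
  measurable_r : Measurable 𝒢.r
  measurable_s : Measurable 𝒢.s
  measurable_inv : Measurable 𝒢.inv
  measurable_mul : Measurable fun p : 𝒢.Composable => 𝒢.mul p.1.1 p.1.2 p.2
  countable_fiber : ∀ y, (𝒢.r ⁻¹' {y}).Countable
  inv_absolutelyContinuous : (𝒢.arrowMeasure μ).map 𝒢.inv ≪ 𝒢.arrowMeasure μ
  absolutelyContinuous_inv : 𝒢.arrowMeasure μ ≪ (𝒢.arrowMeasure μ).map 𝒢.inv

/-- A subgroupoid of `𝒢`: a `μ̃`-measurable subset which contains all units and is closed under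
inverses and products. -/
structure MeasurableSubgroupoid (𝒢 : GroupoidOn X G) (μ : Measure X) where
  carrier : Set G
  nullMeasurableSet : NullMeasurableSet carrier (𝒢.arrowMeasure μ)
  unit_mem : ∀ x, 𝒢.unit x ∈ carrier
  inv_mem : ∀ g, g ∈ carrier → 𝒢.inv g ∈ carrier
  mul_mem : ∀ g h (e : 𝒢.s g = 𝒢.r h), g ∈ carrier → h ∈ carrier → 𝒢.mul g h e ∈ carrier

/-- A subgroupoid as a groupoid on `X` in its own right. -/
def MeasurableSubgroupoid.toGroupoidOn {𝒢 : GroupoidOn X G} {μ : Measure X}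
    (S : 𝒢.MeasurableSubgroupoid μ) : GroupoidOn X S.carrier where
  r g := 𝒢.r g
  s g := 𝒢.s g
  unit x := ⟨𝒢.unit x, S.unit_mem x⟩
  inv g := ⟨𝒢.inv g, S.inv_mem g g.2⟩
  mul g h e := ⟨𝒢.mul g h e, S.mul_mem g h e g.2 h.2⟩
  r_unit x := 𝒢.r_unit x
  s_unit x := 𝒢.s_unit x
  r_inv g := 𝒢.r_inv g
  s_inv g := 𝒢.s_inv g
  r_mul g h e := 𝒢.r_mul g h e
  s_mul g h e := 𝒢.s_mul g h e
  unit_mul g := Subtype.ext (𝒢.unit_mul g)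
  mul_unit g := Subtype.ext (𝒢.mul_unit g)
  inv_mul g := Subtype.ext (𝒢.inv_mul g)
  mul_inv g := Subtype.ext (𝒢.mul_inv g)
  mul_assoc g h k e₁ e₂ := Subtype.ext (𝒢.mul_assoc g h k e₁ e₂)

/-- A homomorphism from `𝒢` to a discrete group `A`: a `μ̃`-measurable map which is
multiplicative at almost every composable pair. (Regarding `A` as a groupoid over a point, its
measure is the counting measure, so every measure on `A` is absolutely continuous.) -/
structure IsHomToGroup (𝒢 : GroupoidOn X G) (μ : Measure X) {A : Type*} [Group A]
    [MeasurableSpace A] (α : G → A) : Prop where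
  aemeasurable : AEMeasurable α (𝒢.arrowMeasure μ)
  map_mul : ∀ᵐ p ∂(𝒢.composableMeasure μ), α (𝒢.mul p.1.1 p.1.2 p.2) = α p.1.1 * α p.1.2

/-- `α` is class-surjective: `α(Gₓ) = A` for almost every `x`. -/
def IsClassSurjective (𝒢 : GroupoidOn X G) (μ : Measure X) {A : Type*} (α : G → A) : Prop :=
  ∀ᵐ x ∂μ, α '' (𝒢.s ⁻¹' {x}) = Set.univ

/-- Positive definiteness: for a.e. `x`, all `g₁, …, gₙ ∈ Gˣ = r⁻¹(x)` and all complex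
`c₁, …, cₙ`, the number `∑ᵢⱼ c̄ᵢ cⱼ φ(gᵢ⁻¹ gⱼ)` is real and nonnegative. -/
def IsPositiveDefinite (𝒢 : GroupoidOn X G) (μ : Measure X) (φ : G → ℂ) : Prop :=
  ∀ᵐ x ∂μ, ∀ (n : ℕ) (g : Fin n → G) (hg : ∀ i, 𝒢.r (g i) = x) (c : Fin n → ℂ),
    0 ≤ ∑ i, ∑ j, (starRingEnd ℂ) (c i) * c j *
      φ (𝒢.mul (𝒢.inv (g i)) (g j) ((𝒢.s_inv (g i)).trans ((hg i).trans (hg j).symm)))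

/-- `φ` is normalized: its value at almost every unit is `1`. -/
def IsNormalized (𝒢 : GroupoidOn X G) (μ : Measure X) (φ : G → ℂ) : Prop :=
  ∀ᵐ x ∂μ, φ (𝒢.unit x) = 1

/-- `φ` is a `c₀`-function: for all `δ, ε > 0` there is a measurable `Y ⊆ X` with `μ(X ∖ Y) < δ`
such that for a.e. `x ∈ Y` only finitely many `g` with `s g = x` and `r g ∈ Y` satisfy
`|φ(g)| > ε`. -/
def IsCZero (𝒢 : GroupoidOn X G) (μ : Measure X) (φ : G → ℂ) : Prop :=
  ∀ δ : ℝ, 0 < δ → ∀ ε : ℝ, 0 < ε → ∃ Y : Set X, NullMeasurableSet Y μ ∧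
    μ Yᶜ < ENNReal.ofReal δ ∧
    ∀ᵐ x ∂μ, x ∈ Y → {g : G | 𝒢.s g = x ∧ 𝒢.r g ∈ Y ∧ ε < ‖φ g‖}.Finite

/-- The Haagerup property: there are normalized positive definite (`μ̃`-measurable)
`c₀`-functions `φₙ` on `𝒢` with `φₙ(g) → 1` for almost every `g`. -/
def HasHaagerupProperty (𝒢 : GroupoidOn X G) (μ : Measure X) : Prop :=
  ∃ φ : ℕ → G → ℂ,
    (∀ n, AEMeasurable (φ n) (𝒢.arrowMeasure μ) ∧ 𝒢.IsPositiveDefinite μ (φ n) ∧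
      𝒢.IsNormalized μ (φ n) ∧ 𝒢.IsCZero μ (φ n)) ∧
    ∀ᵐ g ∂(𝒢.arrowMeasure μ), Tendsto (fun n => φ n g) atTop (𝓝 1)

end Measure

end GroupoidOn

/-- Amenability of a (countable) discrete group: it has a Følner sequence, i.e. a sequence of
non-empty finite subsets `Fₙ` with `|g Fₙ ∆ Fₙ| / |Fₙ| → 0` for every `g`. -/
def IsAmenableGroup (A : Type*) [Group A] : Prop :=
  ∃ F : ℕ → Set A, (∀ n, (F n).Finite ∧ (F n).Nonempty) ∧
    ∀ g : A, Tendsto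
      (fun n => ((symmDiff ((fun a => g * a) '' F n) (F n)).ncard : ℝ) / ((F n).ncard : ℝ))
      atTop (𝓝 0)

/-! Functions on `ker α` are induced to `𝒢`, with Følner sets of `A` as cut-offs. The tool is a
family of Borel sections `σ_b` of `r`, indexed by `b ∈ A`, with `α(σ_{α(g)b}(r g)) = α(g) α(σ_b(s
g))`. The twisted arrow `σ_{α(g)b}(r g)⁻¹ g σ_b(s g)` then lies in `ker α`, and a function `ψ` on
`ker α` and a finite `F ⊆ A` give `Φ(g) = |F|⁻¹ ∑ ψ(twisted arrow)`, the sum being over those `b ∈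
F` with `α(g)b ∈ F`.

Such sections exist because `α(𝒢^{r g}) = α(g) α(𝒢^{s g})`. The first `a`, in an enumeration of `A`,
with `ba ∈ α(𝒢^x)` is the same for the pair `(α(g)b, r g)` as for `(b, s g)`, so prescribing the
value `ba` is equivariant (`exists_isEquivariantSystem`).

Positive definiteness (`induced_posDef`): the substitution `t = α(g_j)b` splits the form of `Φ` into
forms of `ψ`, one for each `t`, in arrows that share their value under `α`; a common left
translation moves these into `ker α`. The `c₀` condition (`isCZero_induced`): `g` is recovered from
its twist and two section values, and outside a small set these values lie in finitely many sets on
which `s` is injective. Convergence: as `ψ → 1`, `Φ(g)` tends to the proportion of `b ∈ F` with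
`α(g)b ∈ F`, and this tends to 1 along a Følner sequence; a diagonal sequence does both at once.

By quasi-invariance all a.e. hypotheses hold everywhere on an invariant conull set
(`exists_invariant`). The sets on which `s` is injective come from the Lusin–Novikov theorem up to
null sets (`exists_disjoint_sections`), which rests on the universal measurability of analytic sets.
-/

/-! ### Universal measurability of analytic sets -/

/-- If the preimage of an open set under a continuous map on the Baire space contains the compact
box below `N`, then it contains a box in which only finitely many coordinates are bounded. -/
theorem exists_box_subset_of_isOpen {O : Set (ℕ → ℕ)} (hO : IsOpen O) {N : ℕ → ℕ}
    (h : {z : ℕ → ℕ | ∀ i, z i ≤ N i} ⊆ O) : ∃ n, {z : ℕ → ℕ | ∀ i < n, z i ≤ N i} ⊆ O := by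
  have hK : IsCompact {z : ℕ → ℕ | ∀ i, z i ≤ N i} := by
    have : {z : ℕ → ℕ | ∀ i, z i ≤ N i} = Set.univ.pi fun i => Set.Iic (N i) := by
      ext z; simp [Pi.le_def]
    rw [this]
    exact isCompact_univ_pi fun i => (Set.finite_Iic (N i)).isCompact
  -- These open sets increase with `n` and cover the compact box, so a single `n` serves for the
  -- whole box.
  have hV : ∀ n, IsOpen {z : ℕ → ℕ | PiNat.cylinder z n ⊆ O} := by
    intro n
    refine isOpen_iff_mem_nhds.2 fun z hz => ?_
    refine mem_of_superset ((PiNat.isOpen_cylinder _ z n).mem_nhds (PiNat.self_mem_cylinder z n)) ?_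
    intro w hw
    rw [PiNat.mem_cylinder_iff_eq] at hw
    simpa [hw] using hz
  obtain ⟨n, hn⟩ := hK.elim_directed_cover _ hV (fun z hz => by
    obtain ⟨v, ⟨x, n, rfl⟩, hzv, hv⟩ :=
      (PiNat.isTopologicalBasis_cylinders (fun _ : ℕ => ℕ)).exists_subset_of_mem_open (h hz) hO
    refine Set.mem_iUnion.2 ⟨n, ?_⟩
    rw [PiNat.mem_cylinder_iff_eq] at hzv
    simpa [hzv] using hv) (Monotone.directed_le fun m n hmn z hz =>
      (PiNat.cylinder_anti z hmn).trans hz)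
  refine ⟨n, fun w hw => ?_⟩
  -- Truncation by `N` moves `w` into the compact box without changing its first `n` coordinates.
  have : (fun i => min (w i) (N i)) ∈ {z : ℕ → ℕ | ∀ i, z i ≤ N i} := fun i => min_le_right _ _
  refine hn this ?_
  intro i hi
  exact (min_eq_left (hw i hi)).symm

/-- Inner regularity of analytic sets. -/
theorem MeasureTheory.AnalyticSet.exists_isCompact_le {X : Type*} [TopologicalSpace X]
    [MeasurableSpace X] (μ : Measure X) [μ.OuterRegular]
    {A : Set X} (hA : AnalyticSet A) {c : ENNReal} (hc : c < μ A) :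
    ∃ K ⊆ A, IsCompact K ∧ c ≤ μ K := by
  rw [AnalyticSet] at hA
  rcases hA with rfl | ⟨f, hf, rfl⟩
  · simp at hc
  let B : ℕ → (ℕ → ℕ) → Set (ℕ → ℕ) := fun n N => {z | ∀ i < n, z i ≤ N i}
  -- Coordinates are bounded one at a time. Continuity from below holds for increasing unions of
  -- arbitrary sets, so some bound `m` on coordinate `n` keeps the measure above `c`.
  have step : ∀ n (N : ℕ → ℕ), c < μ (f '' B n N) →
      ∃ m, c < μ (f '' B (n + 1) (Function.update N n m)) := by
    intro n N h
    have hU : f '' B n N = ⋃ m, f '' B (n + 1) (Function.update N n m) := by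
      rw [← Set.image_iUnion]
      congr 1
      ext z
      simp only [B, Set.mem_iUnion, Set.mem_ofPred_eq]
      constructor
      · intro hz
        refine ⟨z n, fun i hi => ?_⟩
        rcases Nat.lt_succ_iff_lt_or_eq.1 hi with hi | rfl
        · rw [Function.update_of_ne hi.ne]; exact hz i hi
        · simp
      · rintro ⟨m, hm⟩ i hi
        have := hm i (by omega)
        rwa [Function.update_of_ne hi.ne] at this
    have hmono : Monotone fun m => f '' B (n + 1) (Function.update N n m) := by
      intro m m' hmm
      refine Set.image_mono fun z hz i hi => (hz i hi).trans ?_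
      exact Function.update_mono hmm i
    rw [hU, hmono.measure_iUnion] at h
    exact lt_iSup_iff.1 h
  choose! m hm using step
  let N : ℕ → (ℕ → ℕ) := fun n => Nat.rec (fun _ => 0) (fun n N => Function.update N n (m n N)) n
  have hN : ∀ n, c < μ (f '' B n (N n)) := by
    intro n
    induction n with
    | zero => simpa [B, N] using hc
    | succ n ih => exact hm n _ ih
  have hstab : ∀ n i, i < n → N n i = N (i + 1) i := by
    intro n i hi
    induction n with
    | zero => omega
    | succ n ih =>
      rcases Nat.lt_succ_iff_lt_or_eq.1 hi with hi | rfl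
      · rw [← ih hi]
        exact Function.update_of_ne hi.ne _ _
      · rfl
  let M : ℕ → ℕ := fun i => N (i + 1) i
  have hM : ∀ n, B n (N n) = B n M := by
    intro n
    ext z
    exact forall₂_congr fun i hi => by rw [hstab n i hi]
  have hK : IsCompact {z : ℕ → ℕ | ∀ i, z i ≤ M i} := by
    have : {z : ℕ → ℕ | ∀ i, z i ≤ M i} = Set.univ.pi fun i => Set.Iic (M i) := by
      ext z; simp [Pi.le_def]
    rw [this]
    exact isCompact_univ_pi fun i => (Set.finite_Iic (M i)).isCompact
  refine ⟨f '' {z | ∀ i, z i ≤ M i}, Set.image_subset_range _ _, hK.image hf, ?_⟩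
  -- Continuity from above is not available for the possibly nonmeasurable sets `f '' B n M`.
  -- Instead, every open set containing the compact image contains one of them.
  rw [Set.measure_eq_iInf_isOpen]
  refine le_iInf₂ fun O hO => le_iInf fun hOo => ?_
  obtain ⟨n, hn⟩ := exists_box_subset_of_isOpen (hOo.preimage hf) (Set.image_subset_iff.1 hO)
  refine (hN n).le.trans (measure_mono ?_)
  rw [hM]
  exact Set.image_subset_iff.2 hn

/-- Analytic sets are universally measurable. -/
theorem MeasureTheory.AnalyticSet.nullMeasurableSet {X : Type*} [TopologicalSpace X] [T2Space X]
    [MeasurableSpace X] [OpensMeasurableSpace X] (μ : Measure X) [IsFiniteMeasure μ]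
    [μ.OuterRegular] {A : Set X} (hA : AnalyticSet A) : NullMeasurableSet A μ := by
  rcases eq_or_ne (μ A) 0 with h0 | h0
  · exact NullMeasurableSet.of_null h0
  obtain ⟨c, -, hc, hlim⟩ := exists_seq_strictMono_tendsto' (pos_iff_ne_zero.2 h0)
  choose K hKA hK hcK using fun n => hA.exists_isCompact_le μ (hc n).2
  have hL : MeasurableSet (⋃ n, K n) := .iUnion fun n => (hK n).measurableSet
  have hLA : (⋃ n, K n) ⊆ A := Set.iUnion_subset hKA
  have hle : μ A ≤ μ (⋃ n, K n) :=
    le_of_tendsto' hlim fun n => (hcK n).trans (measure_mono (Set.subset_iUnion K n))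
  have hnull : μ (toMeasurable μ A \ ⋃ n, K n) = 0 := by
    rw [measure_sdiff (hLA.trans (subset_toMeasurable μ A)) hL.nullMeasurableSet (measure_ne_top _ _),
      measure_toMeasurable, tsub_eq_zero_of_le hle]
  have : A = (⋃ n, K n) ∪ (A \ ⋃ n, K n) := (Set.union_sdiff_cancel hLA).symm
  rw [this]
  exact hL.nullMeasurableSet.union
    (NullMeasurableSet.of_null (measure_mono_null (Set.sdiff_subset_sdiff_left
      (subset_toMeasurable μ A)) hnull))

/-- Borel images of Borel sets are universally measurable. -/
theorem MeasurableSet.nullMeasurableSet_image {Z X : Type*} [MeasurableSpace Z]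
    [StandardBorelSpace Z] [MeasurableSpace X] [StandardBorelSpace X] (μ : Measure X)
    [IsFiniteMeasure μ] {p : Z → X} (hp : Measurable p) {E : Set Z} (hE : MeasurableSet E) :
    NullMeasurableSet (p '' E) μ := by
  let := upgradeStandardBorel X
  let := upgradeStandardBorel Z
  exact (hE.analyticSet_image hp).nullMeasurableSet μ

/-! ### Lusin–Novikov theorem up to null sets -/

/-- A nonempty countable closed subset of a Polish space has an isolated point. -/
theorem IsClosed.exists_isolated_of_countable {Z : Type*} [TopologicalSpace Z] [PolishSpace Z]
    {C : Set Z} (hC : IsClosed C) (hcount : C.Countable) (hne : C.Nonempty)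
    {b : Set (Set Z)} (hb : TopologicalSpace.IsTopologicalBasis b) :
    ∃ U ∈ b, ∃ z, C ∩ U = {z} := by
  by_contra! hno
  let := TopologicalSpace.upgradeIsCompletelyMetrizable Z
  -- Without isolated points `C` would be perfect, hence contain an injective image of `ℕ → Bool`.
  have hperf : Perfect C := by
    refine ⟨hC, fun z hz => ?_⟩
    rw [accPt_iff_nhds]
    intro V hV
    obtain ⟨U, hU, hzU, hUV⟩ := hb.mem_nhds_iff.1 hV
    by_contra! hV'
    refine hno U hU z (Set.Subset.antisymm (fun w hw => ?_) (by simp [hz, hzU]))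
    exact hV' w ⟨hUV hw.2, hw.1⟩
  obtain ⟨f, hf, -, hinj⟩ := hperf.exists_nat_bool_injection hne
  have : (f ⁻¹' C).Countable := hcount.preimage hinj
  rw [Set.preimage_eq_univ_iff.2 hf] at this
  have hle := Cardinal.mk_le_aleph0_iff.2 (Set.countable_univ_iff.1 this)
  simp only [Cardinal.mk_pi, Cardinal.prod_const, Cardinal.mk_bool, Cardinal.mk_nat,
    Cardinal.lift_id] at hle
  exact (Cardinal.cantor _).not_ge hle

/-- A property of sets which is stable under countable unions has a largest measurable
instance, up to null sets. -/
theorem exists_maximal_measurableSet {X : Type*} [MeasurableSpace X] (μ : Measure X)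
    [IsFiniteMeasure μ] {Q : Set X → Prop} (h0 : Q ∅)
    (hU : ∀ B : ℕ → Set X, (∀ n, Q (B n)) → Q (⋃ n, B n)) :
    ∃ B, MeasurableSet B ∧ Q B ∧ ∀ B', MeasurableSet B' → Q B' → μ (B' \ B) = 0 := by
  let S : Set ENNReal := μ '' {B | MeasurableSet B ∧ Q B}
  have hS : S.Nonempty := ⟨_, ∅, ⟨.empty, h0⟩, rfl⟩
  obtain ⟨u, -, hu, huS⟩ := exists_seq_tendsto_sSup hS (OrderTop.bddAbove S)
  choose B hB hBu using huS
  have hm : MeasurableSet (⋃ n, B n) := .iUnion fun n => (hB n).1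
  have hQ : Q (⋃ n, B n) := hU _ fun n => (hB n).2
  have hsup : sSup S ≤ μ (⋃ n, B n) :=
    le_of_tendsto' hu fun n => (hBu n).symm.le.trans (measure_mono (Set.subset_iUnion B n))
  refine ⟨_, hm, hQ, fun B' hB' hQ' => ?_⟩
  have hQ2 : Q (B' ∪ ⋃ n, B n) := by
    rw [Set.union_eq_iUnion]
    have := hU (fun n => if n = 0 then B' else ⋃ n, B n) (fun n => by split_ifs <;> assumption)
    convert this using 1
    ext x
    simp only [Set.mem_iUnion]
    constructor
    · rintro ⟨i, hi⟩
      cases i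
      · exact ⟨1, by simpa using hi⟩
      · exact ⟨0, by simpa using hi⟩
    · rintro ⟨n, hn⟩
      split_ifs at hn
      · exact ⟨true, hn⟩
      · exact ⟨false, hn⟩
  have hle : μ (B' ∪ ⋃ n, B n) ≤ μ (⋃ n, B n) :=
    (le_sSup ⟨_, ⟨hB'.union hm, hQ2⟩, rfl⟩ : _ ≤ sSup S).trans hsup
  rw [← Set.union_sdiff_right, measure_sdiff Set.subset_union_right hm.nullMeasurableSet
    (measure_ne_top _ _), tsub_eq_zero_of_le hle]

/-- Over almost every point, the set `E` is covered by countably many Borel sets on which the map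
`p` is injective. -/
def HasSectionCover {Z X : Type*} [MeasurableSpace Z] [MeasurableSpace X] (μ : Measure X)
    (p : Z → X) (E : Set Z) : Prop :=
  ∃ C : ℕ → Set Z, (∀ n, MeasurableSet (C n)) ∧ (∀ n, Set.InjOn p (C n)) ∧
    μ (p '' (E \ ⋃ n, C n)) = 0

namespace HasSectionCover

variable {Z X : Type*} [MeasurableSpace Z] [MeasurableSpace X] {μ : Measure X} {p : Z → X}

theorem mono {E F : Set Z} (h : HasSectionCover μ p F) (hEF : E ⊆ F) : HasSectionCover μ p E := by
  obtain ⟨C, hC, hi, h0⟩ := h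
  exact ⟨C, hC, hi, measure_mono_null (Set.image_mono (Set.sdiff_subset_sdiff_left hEF)) h0⟩

theorem iUnion {ι : Type*} [Countable ι] {E : ι → Set Z} (h : ∀ n, HasSectionCover μ p (E n)) :
    HasSectionCover μ p (⋃ n, E n) := by
  choose C hC hi h0 using h
  rcases isEmpty_or_nonempty ι with hι | hι
  · exact ⟨fun _ => ∅, by simp, by simp, by simp⟩
  obtain ⟨f, hf⟩ := exists_surjective_nat (ι × ℕ)
  refine ⟨fun k => C (f k).1 (f k).2, fun k => hC _ _, fun k => hi _ _,
    measure_mono_null ?_ (measure_iUnion_null h0)⟩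
  rw [← Set.image_iUnion]
  refine Set.image_mono ?_
  rintro z ⟨hz, hz'⟩
  obtain ⟨n, hn⟩ := Set.mem_iUnion.1 hz
  refine Set.mem_iUnion.2 ⟨n, hn, fun hz'' => hz' ?_⟩
  obtain ⟨m, hm⟩ := Set.mem_iUnion.1 hz''
  obtain ⟨k, hk⟩ := hf (n, m)
  exact Set.mem_iUnion.2 ⟨k, by simpa [hk] using hm⟩

theorem of_injOn {E : Set Z} (hE : MeasurableSet E) (hi : Set.InjOn p E) :
    HasSectionCover μ p E :=
  ⟨fun _ => E, fun _ => hE, fun _ => hi, by simp [Set.iUnion_const]⟩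

theorem of_null {E : Set Z} (h : μ (p '' E) = 0) : HasSectionCover μ p E :=
  ⟨fun _ => ∅, by simp, by simp, by simpa using h⟩

theorem union {E F : Set Z} (hE : HasSectionCover μ p E) (hF : HasSectionCover μ p F) :
    HasSectionCover μ p (E ∪ F) := by
  rw [Set.union_eq_iUnion]
  exact iUnion fun b => by cases b <;> assumption

end HasSectionCover

/-- The measure-theoretic Lusin–Novikov theorem, for a continuous map. -/
theorem hasSectionCover_of_continuous {Z X : Type*} [TopologicalSpace Z] [PolishSpace Z]
    [MeasurableSpace Z] [BorelSpace Z] [TopologicalSpace X] [PolishSpace X] [MeasurableSpace X]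
    [BorelSpace X] (μ : Measure X) [IsFiniteMeasure μ] {p : Z → X} (hp : Continuous p)
    (hcount : ∀ x, (p ⁻¹' {x}).Countable) : HasSectionCover μ p Set.univ := by
  obtain ⟨b, hbc, -, hb⟩ := TopologicalSpace.exists_countable_basis Z
  have : Countable b := hbc.to_subtype
  have hbm : ∀ U : b, MeasurableSet (U : Set Z) := fun U => (hb.isOpen U.2).measurableSet
  -- Exhaustion: `B U` is the largest base over which the basic open set `U` can be covered by
  -- sections. The claim is that what these leave over, `Rᶜ`, lies over a null set.
  have hmax : ∀ U : b, ∃ B, MeasurableSet B ∧ HasSectionCover μ p (U ∩ p ⁻¹' B) ∧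
      ∀ B', MeasurableSet B' → HasSectionCover μ p (U ∩ p ⁻¹' B') → μ (B' \ B) = 0 := by
    intro U
    refine exists_maximal_measurableSet μ (Q := fun B => HasSectionCover μ p (U ∩ p ⁻¹' B))
      (.of_null (by simp)) fun B hB => ?_
    rw [Set.preimage_iUnion, Set.inter_iUnion]
    exact .iUnion hB
  choose B hBm hBs hBmax using hmax
  let R : Set Z := ⋃ U : b, (U : Set Z) ∩ p ⁻¹' B U
  have hR : HasSectionCover μ p R := .iUnion hBs
  have hRm : MeasurableSet R := .iUnion fun U => (hbm U).inter (hp.measurable (hBm U))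
  let M : b → Set X := fun U => {x | ∃ z, Rᶜ ∩ p ⁻¹' {x} ∩ U = {z}}
  -- Two points in one fibre are separated by disjoint basic open sets, so `M U` is built from
  -- countably many Borel images and is null measurable.
  have hMeq : ∀ U : b, M U = p '' (Rᶜ ∩ U) \
      ⋃ VW : {VW : b × b // Disjoint (VW.1 : Set Z) VW.2},
        p '' (Rᶜ ∩ U ∩ VW.1.1) ∩ p '' (Rᶜ ∩ U ∩ VW.1.2) := by
    intro U
    ext x
    constructor
    · rintro ⟨z, hz⟩
      have hzm : z ∈ Rᶜ ∩ p ⁻¹' {x} ∩ U := hz ▸ rfl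
      refine ⟨⟨z, ⟨hzm.1.1, hzm.2⟩, hzm.1.2⟩, ?_⟩
      simp only [Set.mem_iUnion, not_exists]
      rintro ⟨⟨V, W⟩, hVW⟩ ⟨⟨v, hv, rfl⟩, ⟨w, hw, hwv⟩⟩
      have h1 : v ∈ Rᶜ ∩ p ⁻¹' {p v} ∩ U := ⟨⟨hv.1.1, rfl⟩, hv.1.2⟩
      have h2 : w ∈ Rᶜ ∩ p ⁻¹' {p v} ∩ U := ⟨⟨hw.1.1, hwv⟩, hw.1.2⟩
      rw [hz] at h1 h2
      have h3 : v = w := h1.trans h2.symm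
      exact Set.disjoint_left.1 hVW hv.2 (h3 ▸ hw.2)
    · rintro ⟨⟨z, hz, rfl⟩, hx⟩
      refine ⟨z, Set.Subset.antisymm (fun w hw => ?_)
        (Set.singleton_subset_iff.2 ⟨⟨hz.1, rfl⟩, hz.2⟩)⟩
      by_contra hwz
      obtain ⟨V', W', hV', hW', hwV', hzW', hdis⟩ := t2_separation (show w ≠ z from hwz)
      obtain ⟨V, hV, hwV, hVV⟩ := hb.mem_nhds_iff.1 (hV'.mem_nhds hwV')
      obtain ⟨W, hW, hzW, hWW⟩ := hb.mem_nhds_iff.1 (hW'.mem_nhds hzW')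
      refine hx (Set.mem_iUnion.2 ⟨⟨(⟨V, hV⟩, ⟨W, hW⟩), hdis.mono hVV hWW⟩, ?_, ?_⟩)
      · exact ⟨w, ⟨⟨hw.1.1, hw.2⟩, hwV⟩, hw.1.2⟩
      · exact ⟨z, ⟨hz, hzW⟩, rfl⟩
  have hMm : ∀ U, NullMeasurableSet (M U) μ := by
    intro U
    rw [hMeq U]
    have hRU := hRm.compl.inter (hbm U)
    refine (hRU.nullMeasurableSet_image μ hp.measurable).diff (.iUnion fun VW => ?_)
    exact ((hRU.inter (hbm _)).nullMeasurableSet_image μ hp.measurable).inter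
      ((hRU.inter (hbm _)).nullMeasurableSet_image μ hp.measurable)
  -- Over `M U` the map is injective on `Rᶜ ∩ U`, so by maximality `M U` is almost contained in `B
  -- U`. But the two are disjoint: a point of `U` over `B U` belongs to `R`.
  have hM0 : ∀ U, μ (M U) = 0 := by
    intro U
    obtain ⟨M', hM'M, hM'm, hM'ae⟩ := (hMm U).exists_measurable_subset_ae_eq
    rw [← measure_congr hM'ae]
    have hsec : HasSectionCover μ p (Rᶜ ∩ U ∩ p ⁻¹' M') := by
      refine .of_injOn ((hRm.compl.inter (hbm U)).inter (hp.measurable hM'm)) ?_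
      rintro v ⟨hv, hvM⟩ w ⟨hw, hwM⟩ hvw
      obtain ⟨z, hz⟩ := hM'M hvM
      have h1 : v ∈ Rᶜ ∩ p ⁻¹' {p v} ∩ U := ⟨⟨hv.1, rfl⟩, hv.2⟩
      have h2 : w ∈ Rᶜ ∩ p ⁻¹' {p v} ∩ U := ⟨⟨hw.1, hvw.symm⟩, hw.2⟩
      rw [hz] at h1 h2
      exact h1.trans h2.symm
    have h1 := hBmax U M' hM'm ((hsec.union hR).mono fun z hz => by
      by_cases hzR : z ∈ R
      · exact Or.inr hzR
      · exact Or.inl ⟨⟨hzR, hz.1⟩, hz.2⟩)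
    suffices Disjoint M' (B U) by rwa [this.sdiff_eq_left] at h1
    refine Set.disjoint_left.2 fun x hx hxB => ?_
    obtain ⟨z, hz⟩ := hM'M hx
    have hzm : z ∈ Rᶜ ∩ p ⁻¹' {x} ∩ U := hz ▸ rfl
    have hzx : p z = x := hzm.1.2
    exact hzm.1.1 (Set.mem_iUnion.2 ⟨U, hzm.2, by simpa [hzx] using hxB⟩)
  have hRc : HasSectionCover μ p Rᶜ := by
    refine .of_null (measure_mono_null ?_ (measure_iUnion_null hM0))
    rintro _ ⟨z, hz, rfl⟩
    -- Within a single fibre, removing `R` amounts to removing the open sets `U` with `p z ∈ B U`. A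
    -- nonempty fibre of `Rᶜ` thus has an isolated point, so it lies over some `M U`.
    have hcl : IsClosed (Rᶜ ∩ p ⁻¹' {p z}) := by
      have : Rᶜ ∩ p ⁻¹' {p z} = p ⁻¹' {p z} ∩ ⋂ U : {U : b // p z ∈ B U}, (U.1 : Set Z)ᶜ := by
        ext w
        simp only [R, Set.mem_inter_iff, Set.mem_compl_iff, Set.mem_iUnion, Set.mem_iInter,
          Set.mem_preimage, Set.mem_singleton_iff, not_exists, not_and, Subtype.forall]
        constructor
        · rintro ⟨h1, h2⟩
          exact ⟨h2, fun U hU h3 h4 => h1 U hU h4 (h2 ▸ h3)⟩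
        · rintro ⟨h1, h2⟩
          exact ⟨fun U hU h3 h4 => h2 U hU (h1 ▸ h4) h3, h1⟩
      rw [this]
      exact (isClosed_singleton.preimage hp).inter
        (isClosed_iInter fun U => (hb.isOpen U.1.2).isClosed_compl)
    obtain ⟨U, hU, w, hw⟩ := hcl.exists_isolated_of_countable
      ((hcount (p z)).mono Set.inter_subset_right) ⟨z, hz, rfl⟩ hb
    exact Set.mem_iUnion.2 ⟨⟨U, hU⟩, w, hw⟩
  exact (hR.union hRc).mono fun z _ => em _

/-- The measure-theoretic Lusin–Novikov theorem: a countable-to-one Borel map between standard Borel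
spaces is, over almost every point, injective on each of countably many disjoint Borel sets which
cover the space. -/
theorem exists_disjoint_sections {Z X : Type*} [MeasurableSpace Z] [StandardBorelSpace Z]
    [MeasurableSpace X] [StandardBorelSpace X] (μ : Measure X) [IsFiniteMeasure μ] {p : Z → X}
    (hp : Measurable p) (hcount : ∀ x, (p ⁻¹' {x}).Countable) :
    ∃ C : ℕ → Set Z, (∀ n, MeasurableSet (C n)) ∧ (∀ n, Set.InjOn p (C n)) ∧
      Pairwise (Function.onFun Disjoint C) ∧ ∀ᵐ x ∂μ, p ⁻¹' {x} ⊆ ⋃ n, C n := by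
  have key : HasSectionCover μ p Set.univ := by
    let := upgradeStandardBorel X
    let τ := upgradeStandardBorel Z
    -- A finer Polish topology makes `p` continuous and has the same Borel sets.
    obtain ⟨t', ht', hp', hpol⟩ := hp.exists_continuous
    have hbor : @BorelSpace Z t' _ := by
      refine @BorelSpace.mk Z t' _ ?_
      rw [@borel_eq_borel_of_le Z t' τ.toTopologicalSpace hpol inferInstance ht']
      exact BorelSpace.measurable_eq
    exact @hasSectionCover_of_continuous Z X t' hpol _ hbor _ _ _ _ μ _ p hp' hcount
  obtain ⟨C, hC, hi, h0⟩ := key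
  refine ⟨disjointed C, fun n => .disjointed hC n, fun n => (hi n).mono (disjointed_subset C n),
    disjoint_disjointed C, ?_⟩
  filter_upwards [measure_eq_zero_iff_ae_notMem.1 h0] with x hx z hz
  rw [iUnion_disjointed]
  by_contra hzC
  exact hx ⟨z, ⟨trivial, hzC⟩, hz⟩

/-! ### Fibre counting measures -/

section FiberCounting

variable {X Z W : Type*} [MeasurableSpace X] [MeasurableSpace Z] [MeasurableSpace W]

/-- The counting measures of the fibres of a countable-to-one Borel map form a measurable family.
This is stated for the restriction of the map to a subset (the range of `q`) which agrees with a Borel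
set over almost every point. -/
theorem aemeasurable_count_restrict_fiber [StandardBorelSpace X] [StandardBorelSpace Z]
    (μ : Measure X) [IsFiniteMeasure μ] {p : Z → X} (hp : Measurable p)
    (hcount : ∀ x, (p ⁻¹' {x}).Countable) {q : W → Z} (hq : q.Injective)
    (hW : ‹MeasurableSpace W› = MeasurableSpace.comap q inferInstance) {T : Set Z}
    (hT : MeasurableSet T) (hqT : ∀ᵐ x ∂μ, ∀ z, p z = x → (z ∈ Set.range q ↔ z ∈ T)) :
    AEMeasurable (fun x => (Measure.count : Measure W).restrict ((fun w => p (q w)) ⁻¹' {x})) μ := by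
  obtain ⟨C, hC, hi, hd, hcov⟩ := exists_disjoint_sections μ hp hcount
  obtain ⟨X₁, hX₁, hX₁m, h1⟩ := (hqT.and hcov).exists_measurable_mem
  have hqm : Measurable q := by rw [hW]; exact comap_measurable q
  classical
  refine ⟨fun x => if x ∈ X₁ then
    (Measure.count : Measure W).restrict ((fun w => p (q w)) ⁻¹' {x}) else 0, ?_, ?_⟩
  · refine Measure.measurable_of_measurable_coe _ fun E hE => ?_
    obtain ⟨E', hE', rfl⟩ : ∃ E', MeasurableSet E' ∧ q ⁻¹' E' = E := by
      rw [hW] at hE; exact hE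
    -- Each section contributes at most one point to a fibre, so counting a fibre is summing
    -- indicators of the images of the sections. These images are Borel by injectivity.
    have heq : (fun x => (if x ∈ X₁ then
        (Measure.count : Measure W).restrict ((fun w => p (q w)) ⁻¹' {x}) else 0) (q ⁻¹' E')) =
        X₁.indicator (fun x => ∑' n, (p '' (C n ∩ E' ∩ T)).indicator 1 x) := by
      ext x
      by_cases hx : x ∈ X₁
      · simp only [hx, if_true, Set.indicator_of_mem]
        obtain ⟨hx1, hx2⟩ := h1 x hx
        have hpx : MeasurableSet (p ⁻¹' {x}) := hp (measurableSet_singleton x)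
        rw [Measure.restrict_apply hE,
          Measure.count_apply (hE.inter (show MeasurableSet ((fun w => p (q w)) ⁻¹' {x}) from hqm hpx))]
        have h2 : (q ⁻¹' E' ∩ (fun w => p (q w)) ⁻¹' {x}).encard =
            (⋃ n, C n ∩ E' ∩ T ∩ p ⁻¹' {x}).encard := by
          rw [← hq.encard_image]
          congr 1
          ext z
          simp only [Set.mem_image, Set.mem_iUnion, Set.mem_inter_iff, Set.mem_preimage,
            Set.mem_singleton_iff]
          constructor
          · rintro ⟨w, ⟨hw, hwx⟩, rfl⟩
            obtain ⟨n, hn⟩ := Set.mem_iUnion.1 (hx2 hwx)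
            exact ⟨n, ⟨⟨hn, hw⟩, (hx1 _ hwx).1 ⟨w, rfl⟩⟩, hwx⟩
          · rintro ⟨n, ⟨⟨hn, hz⟩, hzT⟩, hzx⟩
            obtain ⟨w, rfl⟩ := (hx1 z hzx).2 hzT
            exact ⟨w, ⟨hz, hzx⟩, rfl⟩
        have hm : ∀ n, MeasurableSet (C n ∩ E' ∩ T ∩ p ⁻¹' {x}) := fun n =>
          (((hC n).inter hE').inter hT).inter hpx
        rw [h2, ← Measure.count_apply (.iUnion hm), measure_iUnion (fun m n hmn => ?_) hm]
        · refine tsum_congr fun n => ?_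
          rw [Measure.count_apply (hm n)]
          by_cases hn : x ∈ p '' (C n ∩ E' ∩ T)
          · obtain ⟨z, hz, rfl⟩ := hn
            have : C n ∩ E' ∩ T ∩ p ⁻¹' {p z} = {z} := by
              ext w
              refine ⟨fun hw => hi n hw.1.1.1 hz.1.1 hw.2, ?_⟩
              rintro rfl
              exact ⟨hz, rfl⟩
            rw [this, Set.indicator_of_mem (Set.mem_image_of_mem p hz)]
            simp
          · rw [Set.indicator_of_notMem hn, Set.encard_eq_zero.2]
            · exact ENat.toENNReal_zero
            · refine Set.eq_empty_of_forall_notMem fun w hw => hn ⟨w, hw.1, hw.2⟩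
        · exact (hd hmn).mono (fun z hz => hz.1.1.1) (fun z hz => hz.1.1.1)
      · simp [hx]
    rw [heq]
    refine Measurable.indicator (Measurable.tsum fun n => ?_) hX₁m
    exact measurable_one.indicator ((((hC n).inter hE').inter hT).image_of_measurable_injOn hp
      ((hi n).mono fun z hz => hz.1.1))
  · filter_upwards [hX₁] with x hx
    simp [hx]

theorem aemeasurable_count_restrict_fiber_self [StandardBorelSpace X] [StandardBorelSpace Z]
    (μ : Measure X) [IsFiniteMeasure μ] {p : Z → X} (hp : Measurable p)
    (hcount : ∀ x, (p ⁻¹' {x}).Countable) :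
    AEMeasurable (fun x => (Measure.count : Measure Z).restrict (p ⁻¹' {x})) μ :=
  aemeasurable_count_restrict_fiber μ hp hcount (q := id) Function.injective_id
    MeasurableSpace.comap_id.symm .univ (by simp)

/-- Counting measure vanishes only on the empty set. Almost-everywhere conditions on arrows and on
composable pairs thereby become conditions on whole fibres over almost every unit. -/
theorem ae_fiberCountingMeasure_iff [MeasurableSingletonClass X] {μ : Measure X} {p : Z → X}
    (hp : Measurable p)
    (h : AEMeasurable (fun x => (Measure.count : Measure Z).restrict (p ⁻¹' {x})) μ)
    {P : Z → Prop} :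
    (∀ᵐ z ∂fiberCountingMeasure μ p, P z) ↔ ∀ᵐ x ∂μ, ∀ z, p z = x → P z := by
  have hpx : ∀ x, MeasurableSet (p ⁻¹' {x}) := fun x => hp (measurableSet_singleton x)
  constructor
  · intro hP
    obtain ⟨T, hT, hTm, hTP⟩ := hP.exists_measurable_mem
    have h0 : fiberCountingMeasure μ p Tᶜ = 0 := mem_ae_iff.1 hT
    rw [fiberCountingMeasure, Measure.bind_apply hTm.compl h, lintegral_eq_zero_iff'
      (show AEMeasurable (fun x => (Measure.count.restrict (p ⁻¹' {x}) : Measure Z) Tᶜ) μ from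
        (Measure.measurable_coe hTm.compl).comp_aemeasurable h)] at h0
    filter_upwards [h0] with x hx z hz
    refine hTP z (by_contra fun hzT => ?_)
    rw [Pi.zero_apply, Measure.restrict_apply hTm.compl,
      Measure.count_apply (hTm.compl.inter (hpx x))] at hx
    have : Tᶜ ∩ p ⁻¹' {x} = ∅ := by simpa using hx
    exact (this ▸ (⟨hzT, hz⟩ : z ∈ Tᶜ ∩ p ⁻¹' {x}) : z ∈ (∅ : Set Z))
  · intro hP
    obtain ⟨V, hV, hVm, hVP⟩ := hP.exists_measurable_mem
    refine Eventually.mono (p := fun z => p z ∈ V) ?_ fun z hz => hVP _ hz z rfl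
    change fiberCountingMeasure μ p (p ⁻¹' V)ᶜ = 0
    rw [fiberCountingMeasure, Measure.bind_apply (hp hVm).compl h, lintegral_eq_zero_iff'
      (show AEMeasurable (fun x => (Measure.count.restrict (p ⁻¹' {x}) : Measure Z) (p ⁻¹' V)ᶜ) μ
        from (Measure.measurable_coe (hp hVm).compl).comp_aemeasurable h)]
    filter_upwards [hV] with x hx
    rw [Pi.zero_apply, Measure.restrict_apply (hp hVm).compl]
    have : (p ⁻¹' V)ᶜ ∩ p ⁻¹' {x} = ∅ := by
      ext z
      simp only [Set.mem_inter_iff, Set.mem_compl_iff, Set.mem_preimage, Set.mem_singleton_iff,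
        Set.mem_empty_iff_false, iff_false, not_and]
      rintro hz rfl
      exact hz hx
    rw [this, measure_empty]

theorem sigmaFinite_fiberCountingMeasure [StandardBorelSpace X] [StandardBorelSpace Z]
    (μ : Measure X) [IsFiniteMeasure μ] {p : Z → X} (hp : Measurable p)
    (hcount : ∀ x, (p ⁻¹' {x}).Countable) : SigmaFinite (fiberCountingMeasure μ p) := by
  obtain ⟨C, hC, hi, -, hcov⟩ := exists_disjoint_sections μ hp hcount
  have h := aemeasurable_count_restrict_fiber_self μ hp hcount
  refine Measure.sigmaFinite_of_countable (S := insert (⋃ n, C n)ᶜ (Set.range C))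
    ((Set.countable_range C).insert _) ?_ ?_
  · rintro s (rfl | ⟨n, rfl⟩)
    · have : ∀ᵐ z ∂fiberCountingMeasure μ p, z ∈ ⋃ n, C n := by
        rw [ae_fiberCountingMeasure_iff hp h]
        filter_upwards [hcov] with x hx z hz using hx hz
      rw [show fiberCountingMeasure μ p (⋃ n, C n)ᶜ = 0 from this]
      exact ENNReal.zero_lt_top
    · rw [fiberCountingMeasure_apply μ p (fun x => hp (measurableSet_singleton x)) h (hC n)]
      refine lt_of_le_of_lt (lintegral_mono (g := fun _ => 1) fun x => ?_) (by simp)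
      have : (C n ∩ p ⁻¹' {x}).encard ≤ 1 := Set.encard_le_one_iff.2 fun a b ha hb =>
        hi n ha.1 hb.1 (ha.2.trans hb.2.symm)
      exact (ENat.toENNReal_le.2 this).trans_eq ENat.toENNReal_one
  · rw [Set.sUnion_insert, Set.sUnion_range, Set.compl_union_self]

end FiberCounting

/-! ### Diagonal sequences -/

/-- Diagonal sequences: if `f k n → L k` as `n → ∞` for each `k`, and `L k → 1`, almost everywhere,
then `f k (n k) → 1` almost everywhere for suitable `n k`. -/
theorem exists_tendsto_diagonal {Z : Type*} [MeasurableSpace Z] (ν : Measure Z) [SFinite ν]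
    {f : ℕ → ℕ → Z → ℂ} {L : ℕ → Z → ℂ} {l : ℂ} (hf : ∀ k n, Measurable (f k n))
    (hfL : ∀ k, ∀ᵐ z ∂ν, Tendsto (fun n => f k n z) atTop (𝓝 (L k z)))
    (hL : ∀ᵐ z ∂ν, Tendsto (fun k => L k z) atTop (𝓝 l)) :
    ∃ n : ℕ → ℕ, ∀ᵐ z ∂ν, Tendsto (fun k => f k (n k) z) atTop (𝓝 l) := by
  -- For a finite measure with the same null sets, a.e. convergence implies convergence in measure.
  -- The exceptional sets can then be made summable in `k`, and Borel–Cantelli applies.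
  rw [← ae_toFinite] at hL ⊢
  simp_rw [← ae_toFinite (μ := ν)] at hfL
  have hex : ∀ k : ℕ, ∃ n, ν.toFinite {z | ENNReal.ofReal ((1 / 2) ^ k) ≤ edist (f k n z) (L k z)} ≤
      ENNReal.ofReal ((1 / 2) ^ k) := by
    intro k
    have := tendstoInMeasure_of_tendsto_ae (fun n => (hf k n).aestronglyMeasurable) (hfL k)
      (ENNReal.ofReal ((1 / 2) ^ k)) (by positivity)
    exact (this.eventually (eventually_le_nhds (by positivity))).exists
  choose n hn using hex
  refine ⟨n, ?_⟩
  have hsum : ∑' k : ℕ, ENNReal.ofReal ((1 / 2) ^ k) ≠ ⊤ := by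
    rw [← ENNReal.ofReal_tsum_of_nonneg (fun k => by positivity) summable_geometric_two]
    exact ENNReal.ofReal_ne_top
  have hBC := ae_eventually_notMem (ne_top_of_le_ne_top hsum (ENNReal.tsum_le_tsum hn))
  filter_upwards [hBC, hL] with z hz hzL
  refine hzL.congr_dist ?_
  have h0 : Tendsto (fun k : ℕ => ((1 : ℝ) / 2) ^ k) atTop (𝓝 0) :=
    tendsto_pow_atTop_nhds_zero_of_lt_one (by norm_num) (by norm_num)
  refine squeeze_zero' (.of_forall fun _ => dist_nonneg) ?_ h0
  filter_upwards [hz] with k hk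
  rw [dist_comm]
  simp only [not_le, edist_dist] at hk
  exact (ENNReal.ofReal_lt_ofReal_iff (by positivity)).1 hk |>.le

/-! ### Groupoid algebra -/

namespace GroupoidOn

variable {X G : Type*} (𝒢 : GroupoidOn X G)

open Classical in
/-- The product of a groupoid, extended by a junk value to pairs which are not composable. -/
noncomputable def prod (g h : G) : G := if e : 𝒢.s g = 𝒢.r h then 𝒢.mul g h e else g

variable {𝒢} {g h k u : G}

theorem mul_eq_prod (e : 𝒢.s g = 𝒢.r h) : 𝒢.mul g h e = 𝒢.prod g h := (dif_pos e).symm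

theorem r_prod (e : 𝒢.s g = 𝒢.r h) : 𝒢.r (𝒢.prod g h) = 𝒢.r g := by
  rw [← mul_eq_prod e, 𝒢.r_mul]

theorem s_prod (e : 𝒢.s g = 𝒢.r h) : 𝒢.s (𝒢.prod g h) = 𝒢.s h := by
  rw [← mul_eq_prod e, 𝒢.s_mul]

theorem prod_assoc (e₁ : 𝒢.s g = 𝒢.r h) (e₂ : 𝒢.s h = 𝒢.r k) :
    𝒢.prod (𝒢.prod g h) k = 𝒢.prod g (𝒢.prod h k) := by
  have := 𝒢.mul_assoc g h k e₁ e₂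
  rwa [mul_eq_prod, mul_eq_prod, mul_eq_prod, mul_eq_prod] at this

theorem unit_prod (g : G) : 𝒢.prod (𝒢.unit (𝒢.r g)) g = g := by
  rw [← mul_eq_prod (𝒢.s_unit _), 𝒢.unit_mul]

theorem prod_unit (g : G) : 𝒢.prod g (𝒢.unit (𝒢.s g)) = g := by
  rw [← mul_eq_prod (𝒢.r_unit _).symm, 𝒢.mul_unit]

theorem inv_prod_self (g : G) : 𝒢.prod (𝒢.inv g) g = 𝒢.unit (𝒢.s g) := by
  rw [← mul_eq_prod (𝒢.s_inv _), 𝒢.inv_mul]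

theorem prod_inv_self (g : G) : 𝒢.prod g (𝒢.inv g) = 𝒢.unit (𝒢.r g) := by
  rw [← mul_eq_prod (𝒢.r_inv _).symm, 𝒢.mul_inv]

theorem inv_prod_cancel_left (e : 𝒢.s g = 𝒢.r h) : 𝒢.prod (𝒢.inv g) (𝒢.prod g h) = h := by
  rw [← prod_assoc (𝒢.s_inv g) e, inv_prod_self, e, unit_prod]

theorem prod_inv_cancel_left (e : 𝒢.r g = 𝒢.r h) : 𝒢.prod g (𝒢.prod (𝒢.inv g) h) = h := by
  rw [← prod_assoc (𝒢.r_inv g).symm ((𝒢.s_inv g).trans e), prod_inv_self, e, unit_prod]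

theorem prod_inv_cancel_right (e : 𝒢.s g = 𝒢.r h) : 𝒢.prod (𝒢.prod g h) (𝒢.inv h) = g := by
  rw [prod_assoc e (𝒢.r_inv h).symm, prod_inv_self, ← e, prod_unit]

theorem eq_inv_of_prod_eq_unit (e : 𝒢.s g = 𝒢.r h) (hgh : 𝒢.prod g h = 𝒢.unit (𝒢.r g)) :
    h = 𝒢.inv g := by
  rw [← inv_prod_cancel_left e, hgh, ← 𝒢.s_inv, prod_unit]

theorem inv_inv (g : G) : 𝒢.inv (𝒢.inv g) = g :=
  (eq_inv_of_prod_eq_unit (𝒢.s_inv g) (by rw [inv_prod_self, 𝒢.r_inv])).symm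

theorem inv_prod (e : 𝒢.s g = 𝒢.r h) :
    𝒢.inv (𝒢.prod g h) = 𝒢.prod (𝒢.inv h) (𝒢.inv g) := by
  have e' : 𝒢.s (𝒢.inv h) = 𝒢.r (𝒢.inv g) := by rw [𝒢.s_inv, 𝒢.r_inv, e]
  refine (eq_inv_of_prod_eq_unit ?_ ?_).symm
  · rw [s_prod e, r_prod e', 𝒢.r_inv]
  · rw [prod_assoc e (by rw [r_prod e', 𝒢.r_inv]),
      prod_inv_cancel_left (by rw [𝒢.r_inv, e]), prod_inv_self, r_prod e]

/-- Since `g⁻¹ h` is invariant under left translation, arrows with a common range may be translated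
into the kernel. -/
theorem inv_prod_inv_prod (eg : 𝒢.r u = 𝒢.r g) (eh : 𝒢.r u = 𝒢.r h) :
    𝒢.prod (𝒢.inv (𝒢.prod (𝒢.inv u) g)) (𝒢.prod (𝒢.inv u) h) = 𝒢.prod (𝒢.inv g) h := by
  have eg' : 𝒢.s (𝒢.inv u) = 𝒢.r g := (𝒢.s_inv u).trans eg
  rw [inv_prod eg', inv_inv,
    prod_assoc (by rw [𝒢.s_inv, eg]) (by rw [r_prod ((𝒢.s_inv u).trans eh), 𝒢.r_inv]),
    prod_inv_cancel_left eh]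

theorem conj_inv_prod {v w : G} (e : 𝒢.r g = 𝒢.r h) (ev : 𝒢.s g = 𝒢.r v) (ew : 𝒢.s h = 𝒢.r w) :
    𝒢.prod (𝒢.inv v) (𝒢.prod (𝒢.prod (𝒢.inv g) h) w) =
      𝒢.prod (𝒢.inv (𝒢.prod g v)) (𝒢.prod h w) := by
  have e' : 𝒢.s (𝒢.inv g) = 𝒢.r h := (𝒢.s_inv g).trans e
  rw [inv_prod ev, prod_assoc e' ew, prod_assoc (by rw [𝒢.s_inv, 𝒢.r_inv, ev])
    (by rw [𝒢.s_inv, r_prod ew, e])]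

/-! ### Induction of functions from the kernel -/

section Induced

variable {A : Type*} [Group A]

variable (𝒢) in
/-- The arrow `σ_{α(g) b}(r g)⁻¹ g σ_b(s g)`, where `σ` is a family of sections of `r`. -/
noncomputable def twist (α : G → A) (σ : A → X → G) (b : A) (g : G) : G :=
  𝒢.prod (𝒢.inv (σ (α g * b) (𝒢.r g))) (𝒢.prod g (σ b (𝒢.s g)))

open Classical in
variable (𝒢) in
/-- The function on `𝒢` induced from a function on the kernel of `α`, by means of the sections `σ`
and the uniform distribution on `F`. -/
noncomputable def induced (α : G → A) (σ : A → X → G) (F : Finset A) (ψ : G → ℂ) (g : G) : ℂ :=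
  (F.card : ℂ)⁻¹ * ∑ b ∈ F, if α g * b ∈ F then ψ (𝒢.twist α σ b g) else 0

/-- The sections `σ b` of `r` over the invariant set `W` are equivariant under the homomorphism `α`. -/
structure IsEquivariantSystem (𝒢 : GroupoidOn X G) (W : Set X) (α : G → A) (σ : A → X → G) :
    Prop where
  s_mem : ∀ g, 𝒢.r g ∈ W → 𝒢.s g ∈ W
  map_prod : ∀ g h, 𝒢.s g = 𝒢.r h → 𝒢.r g ∈ W → α (𝒢.prod g h) = α g * α h
  r_section : ∀ b, ∀ x ∈ W, 𝒢.r (σ b x) = x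
  map_section : ∀ b g, 𝒢.r g ∈ W → α (σ (α g * b) (𝒢.r g)) = α g * α (σ b (𝒢.s g))

namespace IsEquivariantSystem

variable {W : Set X} {α : G → A} {σ : A → X → G} (H : 𝒢.IsEquivariantSystem W α σ)
include H

theorem r_mem (hg : 𝒢.s g ∈ W) : 𝒢.r g ∈ W := by
  rw [← 𝒢.s_inv]
  exact H.s_mem _ (by rwa [𝒢.r_inv])

theorem map_unit {x : X} (hx : x ∈ W) : α (𝒢.unit x) = 1 := by
  have h := H.map_prod (𝒢.unit x) (𝒢.unit x) (by rw [𝒢.s_unit, 𝒢.r_unit]) (by rwa [𝒢.r_unit])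
  have h' := prod_unit (𝒢 := 𝒢) (𝒢.unit x)
  rw [𝒢.s_unit] at h'
  rw [h'] at h
  exact left_eq_mul.1 h

theorem map_inv (hg : 𝒢.r g ∈ W) : α (𝒢.inv g) = (α g)⁻¹ := by
  have h := H.map_prod g (𝒢.inv g) (𝒢.r_inv g).symm hg
  rw [prod_inv_self, H.map_unit hg] at h
  exact (inv_eq_of_mul_eq_one_right h.symm).symm

section Twist

variable (b : A) (hg : 𝒢.r g ∈ W)
include hg

theorem twist_aux : 𝒢.s g = 𝒢.r (σ b (𝒢.s g)) ∧
    𝒢.s (𝒢.inv (σ (α g * b) (𝒢.r g))) = 𝒢.r (𝒢.prod g (σ b (𝒢.s g))) := by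
  have h := (H.r_section b _ (H.s_mem g hg)).symm
  exact ⟨h, by rw [𝒢.s_inv, H.r_section _ _ hg, r_prod h]⟩

theorem r_twist : 𝒢.r (𝒢.twist α σ b g) = 𝒢.s (σ (α g * b) (𝒢.r g)) := by
  rw [twist, r_prod (H.twist_aux b hg).2, 𝒢.r_inv]

theorem s_twist : 𝒢.s (𝒢.twist α σ b g) = 𝒢.s (σ b (𝒢.s g)) := by
  rw [twist, s_prod (H.twist_aux b hg).2, s_prod (H.twist_aux b hg).1]

theorem map_twist : α (𝒢.twist α σ b g) = 1 := by
  have h2 : 𝒢.r (σ (α g * b) (𝒢.r g)) ∈ W := by rwa [H.r_section _ _ hg]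
  rw [twist, H.map_prod _ _ (H.twist_aux b hg).2 (by rw [𝒢.r_inv]; exact H.s_mem _ h2),
    H.map_inv h2, H.map_prod _ _ (H.twist_aux b hg).1 hg, H.map_section b g hg, inv_mul_cancel]

/-- Apart from its twist, `g` is determined by two values of the sections. This bounds the number of
`g` with a given twist in the `c₀` estimate. -/
theorem eq_of_twist : g = 𝒢.prod (𝒢.prod (σ (α g * b) (𝒢.r g)) (𝒢.twist α σ b g))
    (𝒢.inv (σ b (𝒢.s g))) := by
  rw [twist, prod_inv_cancel_left, prod_inv_cancel_right (H.twist_aux b hg).1]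
  rw [← 𝒢.s_inv]
  exact (H.twist_aux b hg).2

end Twist

theorem induced_unit {F : Finset A} (hF : F.Nonempty) {ψ : G → ℂ}
    (hψ : ∀ x ∈ W, ψ (𝒢.unit x) = 1) {x : X} (hx : x ∈ W) :
    𝒢.induced α σ F ψ (𝒢.unit x) = 1 := by
  have hr : 𝒢.r (𝒢.unit x) ∈ W := by rwa [𝒢.r_unit]
  have htw : ∀ b, 𝒢.twist α σ b (𝒢.unit x) = 𝒢.unit (𝒢.s (σ b x)) := by
    intro b
    have h1 : 𝒢.prod (𝒢.unit x) (σ b x) = σ b x := by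
      have := unit_prod (𝒢 := 𝒢) (σ b x)
      rwa [H.r_section b x hx] at this
    rw [twist, H.map_unit hx, one_mul, 𝒢.r_unit, 𝒢.s_unit, h1, inv_prod_self]
  have hc : (F.card : ℂ) ≠ 0 := by exact_mod_cast hF.card_pos.ne'
  rw [induced, Finset.sum_congr rfl (g := fun _ => 1), Finset.sum_const, nsmul_one, inv_mul_cancel₀ hc]
  intro b hb
  rw [H.map_unit hx, one_mul, if_pos hb, htw]
  exact hψ _ (H.s_mem _ (by rwa [H.r_section b x hx]))

/-- For fixed `t`, the arrows `h t i` all have the value `α (σ t x)` under `α`, so translating them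
by `(σ t x)⁻¹` reduces to positive definiteness on the kernel, at the unit `s (σ t x)`. The
coefficients `d t` encode the cut-off by `F`. -/
theorem induced_posDef {F : Finset A} {ψ : G → ℂ}
    (hψ : ∀ x ∈ W, ∀ (n : ℕ) (k : Fin n → G), (∀ i, 𝒢.r (k i) = x) → (∀ i, α (k i) = 1) →
      ∀ c : Fin n → ℂ, 0 ≤ ∑ i, ∑ j, (starRingEnd ℂ) (c i) * c j *
        ψ (𝒢.prod (𝒢.inv (k i)) (k j)))
    {x : X} (hx : x ∈ W) {n : ℕ} {k : Fin n → G} (hk : ∀ i, 𝒢.r (k i) = x) (c : Fin n → ℂ) :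
    0 ≤ ∑ i, ∑ j, (starRingEnd ℂ) (c i) * c j *
      𝒢.induced α σ F ψ (𝒢.prod (𝒢.inv (k i)) (k j)) := by
  classical
  have hkW : ∀ i, 𝒢.r (k i) ∈ W := fun i => (hk i).symm ▸ hx
  have hsW : ∀ i, 𝒢.s (k i) ∈ W := fun i => H.s_mem _ (hkW i)
  let T : Finset A := Finset.univ.biUnion fun j => F.image (α (k j) * ·)
  let h : A → Fin n → G := fun t i => 𝒢.prod (k i) (σ ((α (k i))⁻¹ * t) (𝒢.s (k i)))
  let d : A → Fin n → ℂ := fun t i => if (α (k i))⁻¹ * t ∈ F then c i else 0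
  have hcomp : ∀ t i, 𝒢.s (k i) = 𝒢.r (σ ((α (k i))⁻¹ * t) (𝒢.s (k i))) :=
    fun t i => (H.r_section _ _ (hsW i)).symm
  have hrh : ∀ t i, 𝒢.r (h t i) = x := fun t i => by rw [r_prod (hcomp t i), hk]
  have hαh : ∀ t i, α (h t i) = α (σ t x) := by
    intro t i
    rw [H.map_prod _ _ (hcomp t i) (hkW i), ← H.map_section _ _ (hkW i), mul_inv_cancel_left, hk]
  -- Substitution `t = α (k j) * b`: then `α (k i)⁻¹ * t = α (k i⁻¹ k j) * b`, and the two
  -- membership conditions become symmetric in `i` and `j`.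
  have hterm : ∀ i j, ∑ b ∈ F, (if α (𝒢.prod (𝒢.inv (k i)) (k j)) * b ∈ F then
      ψ (𝒢.twist α σ b (𝒢.prod (𝒢.inv (k i)) (k j))) else 0) =
      ∑ t ∈ T, if (α (k i))⁻¹ * t ∈ F ∧ (α (k j))⁻¹ * t ∈ F then
        ψ (𝒢.prod (𝒢.inv (h t i)) (h t j)) else 0 := by
    intro i j
    have e : 𝒢.r (k i) = 𝒢.r (k j) := (hk i).trans (hk j).symm
    have e' : 𝒢.s (𝒢.inv (k i)) = 𝒢.r (k j) := (𝒢.s_inv _).trans e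
    have hα : α (𝒢.prod (𝒢.inv (k i)) (k j)) = (α (k i))⁻¹ * α (k j) := by
      rw [H.map_prod _ _ e' (by rw [𝒢.r_inv]; exact hsW i), H.map_inv (hkW i)]
    have hsub : F.image (α (k j) * ·) ⊆ T :=
      Finset.subset_biUnion_of_mem (fun j => F.image (α (k j) * ·)) (Finset.mem_univ j)
    rw [← Finset.sum_subset hsub, Finset.sum_image fun a _ b _ hab => mul_left_cancel hab]
    · refine Finset.sum_congr rfl fun b hb => ?_
      rw [hα, inv_mul_cancel_left, _root_.mul_assoc]
      simp only [hb, and_true]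
      split_ifs with hF
      · congr 1
        simp only [h, twist, r_prod e', s_prod e', 𝒢.r_inv, hα, inv_mul_cancel_left, _root_.mul_assoc]
        refine conj_inv_prod e ?_ ?_
        · exact (H.r_section _ _ (hsW i)).symm
        · exact (H.r_section _ _ (hsW j)).symm
      · rfl
    · intro t _ ht
      refine if_neg fun h => ht (Finset.mem_image.2 ⟨_, h.2, mul_inv_cancel_left _ _⟩)
  have hpos : ∀ t, 0 ≤ ∑ i, ∑ j, (starRingEnd ℂ) (d t i) * d t j *
      ψ (𝒢.prod (𝒢.inv (h t i)) (h t j)) := by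
    intro t
    have hrs : 𝒢.r (σ t x) = x := H.r_section t x hx
    have hz : 𝒢.s (σ t x) ∈ W := H.s_mem _ (hrs.symm ▸ hx)
    have hc : ∀ i, 𝒢.s (𝒢.inv (σ t x)) = 𝒢.r (h t i) := fun i => by rw [𝒢.s_inv, hrs, hrh]
    have := hψ _ hz n (fun i => 𝒢.prod (𝒢.inv (σ t x)) (h t i))
      (fun i => by rw [r_prod (hc i), 𝒢.r_inv])
      (fun i => by rw [H.map_prod _ _ (hc i) (by rwa [𝒢.r_inv]), H.map_inv (hrs.symm ▸ hx), hαh,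
        inv_mul_cancel]) (d t)
    simpa only [inv_prod_inv_prod (hrs.trans (hrh t _).symm) (hrs.trans (hrh t _).symm)] using this
  have hsum : ∑ i, ∑ j, (starRingEnd ℂ) (c i) * c j *
      𝒢.induced α σ F ψ (𝒢.prod (𝒢.inv (k i)) (k j)) =
      (F.card : ℂ)⁻¹ * ∑ t ∈ T, ∑ i, ∑ j, (starRingEnd ℂ) (d t i) * d t j *
        ψ (𝒢.prod (𝒢.inv (h t i)) (h t j)) := by
    rw [Finset.sum_comm (s := T), Finset.mul_sum]
    refine Finset.sum_congr rfl fun i _ => ?_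
    rw [Finset.sum_comm (s := T), Finset.mul_sum]
    refine Finset.sum_congr rfl fun j _ => ?_
    rw [induced, hterm, mul_left_comm, Finset.mul_sum]
    congr 1
    refine Finset.sum_congr rfl fun t _ => ?_
    by_cases h1 : (α (k i))⁻¹ * t ∈ F <;> by_cases h2 : (α (k j))⁻¹ * t ∈ F <;> simp [d, h1, h2]
  rw [hsum]
  refine mul_nonneg ?_ (Finset.sum_nonneg fun t _ => hpos t)
  rw [← Complex.ofReal_natCast, ← Complex.ofReal_inv]
  exact Complex.zero_le_real.2 (by positivity)

end IsEquivariantSystem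

/-- A large value of the induced function comes from a large value of the given function. -/
theorem exists_lt_norm_of_lt_norm_induced {α : G → A} {σ : A → X → G} {F : Finset A} {ψ : G → ℂ}
    {ε : ℝ} (hε : 0 ≤ ε) (hg : ε < ‖𝒢.induced α σ F ψ g‖) :
    ∃ b ∈ F, α g * b ∈ F ∧ ε < ‖ψ (𝒢.twist α σ b g)‖ := by
  by_contra! hno
  refine hg.not_ge ?_
  rcases F.eq_empty_or_nonempty with rfl | hF
  · simpa [induced] using hε
  · rw [induced, norm_mul, norm_inv, Complex.norm_natCast,
      inv_mul_le_iff₀ (by exact_mod_cast hF.card_pos), ← nsmul_eq_mul]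
    refine (norm_sum_le _ _).trans (Finset.sum_le_card_nsmul _ _ _ fun b hb => ?_)
    split_ifs with h
    · exact hno b hb h
    · simpa using hε

-- The limit is the proportion of `F` that left translation by `α g` keeps inside `F`, which is what
-- the Følner condition controls.
open Classical in
theorem tendsto_induced {α : G → A} {σ : A → X → G} {F : Finset A} {ψ : ℕ → G → ℂ}
    (hψ : ∀ b, Tendsto (fun n => ψ n (𝒢.twist α σ b g)) atTop (𝓝 1)) :
    Tendsto (fun n => 𝒢.induced α σ F (ψ n) g) atTop
      (𝓝 ((F.card : ℂ)⁻¹ * (F.filter fun b => α g * b ∈ F).card)) := by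
  rw [Finset.card_filter, Nat.cast_sum]
  refine Tendsto.const_mul _ (tendsto_finsetSum _ fun b _ => ?_)
  split_ifs
  · simpa using hψ b
  · simp

end Induced

end GroupoidOn

/-! ### Følner sets -/

/-- A Følner sequence of finite subsets, in terms of the proportion of points which are not moved out
of the subset. -/
theorem IsAmenableGroup.exists_finset_tendsto {A : Type*} [Group A] [DecidableEq A]
    (hA : IsAmenableGroup A) : ∃ F : ℕ → Finset A, (∀ n, (F n).Nonempty) ∧ ∀ a : A,
      Tendsto (fun n => (((F n).card : ℂ)⁻¹ * ((F n).filter fun b => a * b ∈ F n).card)) atTop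
        (𝓝 1) := by
  obtain ⟨F, hF, hlim⟩ := hA
  lift F to ℕ → Finset A using fun n => (hF n).1
  have hne : ∀ n, (F n).Nonempty := fun n => by simpa using (hF n).2
  refine ⟨F, hne, fun a => ?_⟩
  rw [tendsto_iff_dist_tendsto_zero]
  refine squeeze_zero (fun _ => dist_nonneg) (fun n => ?_) (hlim a)
  have hc : (0 : ℝ) < (F n).card := by exact_mod_cast (hne n).card_pos
  have hc' : ((F n).card : ℂ) ≠ 0 := by exact_mod_cast hc.ne'
  have hsum : ((F n).filter fun b => a * b ∈ F n).card +
      ((F n).filter fun b => ¬ a * b ∈ F n).card = (F n).card :=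
    Finset.card_filter_add_card_filter_not _
  -- The map `b ↦ a * b` sends the points moved out of `F n` injectively into `a (F n) ∖ F n`.
  have hsub : ((F n).filter fun b => ¬ a * b ∈ F n).card ≤
      (symmDiff ((fun b => a * b) '' (F n : Set A)) (F n : Set A)).ncard := by
    rw [← Finset.card_image_of_injective _ (mul_right_injective a), ← Set.ncard_coe_finset]
    refine Set.ncard_le_ncard (fun x hx => ?_)
      ((((F n).finite_toSet.image _).union (F n).finite_toSet).subset symmDiff_le_sup)
    simp only [Finset.coe_image, Set.mem_image, Finset.mem_coe, Finset.mem_filter] at hx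
    obtain ⟨b, ⟨hb, hb'⟩, rfl⟩ := hx
    exact Or.inl ⟨⟨b, hb, rfl⟩, hb'⟩
  have heq : ((F n).card : ℂ)⁻¹ * ((F n).filter fun b => a * b ∈ F n).card - 1 =
      -(((F n).card : ℂ)⁻¹ * ((F n).filter fun b => ¬ a * b ∈ F n).card) := by
    field_simp
    rw [← hsum]
    push_cast
    ring
  rw [dist_eq_norm, heq, norm_neg, norm_mul, norm_inv, Complex.norm_natCast, Complex.norm_natCast,
    Set.ncard_coe_finset, inv_mul_eq_div]
  gcongr

/-! ### Measurability and null sets in the groupoid -/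

namespace GroupoidOn

variable {X G A : Type*} [MeasurableSpace X] [StandardBorelSpace X] [MeasurableSpace G]
  [StandardBorelSpace G] {μ : Measure X} {𝒢 : GroupoidOn X G}

namespace IsDiscreteMeasured

theorem measurable_prod (h𝒢 : 𝒢.IsDiscreteMeasured μ) :
    Measurable fun p : G × G => 𝒢.prod p.1 p.2 := by
  classical
  have hm : MeasurableSet {p : G × G | 𝒢.s p.1 = 𝒢.r p.2} :=
    measurableSet_eq_fun (h𝒢.measurable_s.comp measurable_fst) (h𝒢.measurable_r.comp measurable_snd)
  have := Measurable.dite (s := {p : G × G | 𝒢.s p.1 = 𝒢.r p.2}) h𝒢.measurable_mul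
    (g := fun p => p.1.1) (measurable_fst.comp measurable_subtype_coe) hm
  convert! this using 1

theorem countable_fiber_s (h𝒢 : 𝒢.IsDiscreteMeasured μ) (x : X) : (𝒢.s ⁻¹' {x}).Countable := by
  refine ((h𝒢.countable_fiber x).image 𝒢.inv).mono fun g hg =>
    (Set.mem_image _ _ _).2 ⟨𝒢.inv g, ?_, inv_inv g⟩
  rw [Set.mem_preimage, 𝒢.r_inv]
  exact hg

theorem measurable_twist [Group A] [Countable A] [MeasurableSpace A] [DiscreteMeasurableSpace A]
    (h𝒢 : 𝒢.IsDiscreteMeasured μ) {α : G → A} (hα : Measurable α) {σ : A → X → G}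
    (hσ : ∀ b, Measurable (σ b)) (b : A) : Measurable (𝒢.twist α σ b) := by
  have h1 : Measurable fun g => σ (α g * b) (𝒢.r g) := by
    have : Measurable fun p : A × X => σ p.1 p.2 := measurable_from_prod_countable_right hσ
    exact this.comp (((measurable_of_countable fun a => a * b).comp hα).prodMk h𝒢.measurable_r)
  exact h𝒢.measurable_prod.comp ((h𝒢.measurable_inv.comp h1).prodMk
    (h𝒢.measurable_prod.comp (measurable_id.prodMk ((hσ b).comp h𝒢.measurable_s))))

theorem measurable_induced [Group A] [Countable A] [MeasurableSpace A] [DiscreteMeasurableSpace A]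
    (h𝒢 : 𝒢.IsDiscreteMeasured μ) {α : G → A} (hα : Measurable α) {σ : A → X → G}
    (hσ : ∀ b, Measurable (σ b)) (F : Finset A) {ψ : G → ℂ} (hψ : Measurable ψ) :
    Measurable (𝒢.induced α σ F ψ) := by
  classical
  refine Measurable.const_mul (Finset.measurable_fun_sum _ fun b _ => ?_) _
  refine Measurable.ite ?_ (hψ.comp (h𝒢.measurable_twist hα hσ b)) measurable_const
  exact hα (MeasurableSet.of_discrete (s := {a | a * b ∈ F}))

variable [IsFiniteMeasure μ]

theorem ae_arrowMeasure_iff (h𝒢 : 𝒢.IsDiscreteMeasured μ) {P : G → Prop} :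
    (∀ᵐ g ∂𝒢.arrowMeasure μ, P g) ↔ ∀ᵐ x ∂μ, ∀ g, 𝒢.s g = x → P g :=
  ae_fiberCountingMeasure_iff h𝒢.measurable_s
    (aemeasurable_count_restrict_fiber_self μ h𝒢.measurable_s h𝒢.countable_fiber_s)

theorem sigmaFinite_arrowMeasure (h𝒢 : 𝒢.IsDiscreteMeasured μ) : SigmaFinite (𝒢.arrowMeasure μ) :=
  sigmaFinite_fiberCountingMeasure μ h𝒢.measurable_s h𝒢.countable_fiber_s

theorem ae_composableMeasure_iff (h𝒢 : 𝒢.IsDiscreteMeasured μ) {P : 𝒢.Composable → Prop} :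
    (∀ᵐ p ∂𝒢.composableMeasure μ, P p) ↔ ∀ᵐ x ∂μ, ∀ p : 𝒢.Composable, 𝒢.s p.1.2 = x → P p := by
  have hm : MeasurableSet {p : G × G | 𝒢.s p.1 = 𝒢.r p.2} :=
    measurableSet_eq_fun (h𝒢.measurable_s.comp measurable_fst) (h𝒢.measurable_r.comp measurable_snd)
  have : StandardBorelSpace 𝒢.Composable := hm.standardBorel
  have hp : Measurable fun p : 𝒢.Composable => 𝒢.s p.1.2 :=
    h𝒢.measurable_s.comp (measurable_snd.comp measurable_subtype_coe)
  refine ae_fiberCountingMeasure_iff hp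
    (aemeasurable_count_restrict_fiber_self μ hp fun x => ?_)
  refine (((h𝒢.countable_fiber_s x).biUnion fun h _ =>
    ((h𝒢.countable_fiber_s (𝒢.r h)).image fun g => (g, h))).preimage Subtype.val_injective).mono ?_
  rintro ⟨⟨g, h⟩, e⟩ hx
  exact Set.mem_biUnion (show h ∈ 𝒢.s ⁻¹' {x} from hx) ⟨g, e, rfl⟩

/-- Quasi-invariance: the saturation of a null set is null. -/
theorem ae_forall_r (h𝒢 : 𝒢.IsDiscreteMeasured μ) {P : X → Prop} (hP : ∀ᵐ x ∂μ, P x) :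
    ∀ᵐ x ∂μ, ∀ g, 𝒢.s g = x → P (𝒢.r g) := by
  rw [← h𝒢.ae_arrowMeasure_iff (P := fun g => P (𝒢.r g))]
  have h1 : ∀ᵐ g ∂𝒢.arrowMeasure μ, P (𝒢.s g) := by
    rw [h𝒢.ae_arrowMeasure_iff]
    filter_upwards [hP] with x hx g hg
    rwa [hg]
  have h2 := ae_of_ae_map h𝒢.measurable_inv.aemeasurable
    (h𝒢.inv_absolutelyContinuous.ae_le h1)
  filter_upwards [h2] with g hg
  rwa [𝒢.s_inv] at hg

theorem ae_forall_s (h𝒢 : 𝒢.IsDiscreteMeasured μ) {P : X → Prop} (hP : ∀ᵐ x ∂μ, P x) :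
    ∀ᵐ x ∂μ, ∀ g, 𝒢.r g = x → P (𝒢.s g) := by
  filter_upwards [h𝒢.ae_forall_r hP] with x hx g hg
  have := hx (𝒢.inv g) (by rw [𝒢.s_inv, hg])
  rwa [𝒢.r_inv] at this

/-- Every conull set contains an invariant conull set. -/
theorem exists_invariant (h𝒢 : 𝒢.IsDiscreteMeasured μ) {P : X → Prop} (hP : ∀ᵐ x ∂μ, P x) :
    ∃ W : Set X, (∀ᵐ x ∂μ, x ∈ W) ∧ (∀ x ∈ W, P x) ∧ ∀ g, 𝒢.r g ∈ W → 𝒢.s g ∈ W := by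
  -- These are the points whose whole orbit satisfies `P`.
  refine ⟨{x | ∀ g, 𝒢.s g = x → P (𝒢.r g)}, h𝒢.ae_forall_r hP, fun x hx => ?_, ?_⟩
  · simpa [𝒢.r_unit] using hx (𝒢.unit x) (𝒢.s_unit x)
  · intro g hg k hk
    have e : 𝒢.s k = 𝒢.r (𝒢.inv g) := by rw [𝒢.r_inv, hk]
    have := hg (𝒢.prod k (𝒢.inv g)) (by rw [s_prod e, 𝒢.s_inv])
    rwa [r_prod e] at this

end IsDiscreteMeasured

end GroupoidOn

/-! ### Equivariant Borel sections -/

/-- An injective Borel map on a Borel set has a Borel left inverse. -/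
theorem exists_measurable_leftInvOn {Z X : Type*} [MeasurableSpace Z] [StandardBorelSpace Z]
    [Nonempty Z] [MeasurableSpace X] [StandardBorelSpace X] {f : Z → X} (hf : Measurable f)
    {D : Set Z} (hD : MeasurableSet D) (hi : Set.InjOn f D) :
    ∃ τ : X → Z, Measurable τ ∧ Set.LeftInvOn τ f D := by
  have := hD.standardBorel
  have hemb : MeasurableEmbedding (fun z : D => f z) :=
    (hf.comp measurable_subtype_coe).measurableEmbedding fun a b hab =>
      Subtype.ext (hi a.2 b.2 hab)
  obtain ⟨τ, hτ, hτf⟩ := hemb.exists_measurable_extend (g := Subtype.val) measurable_subtype_coe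
    fun _ => inferInstance
  exact ⟨τ, hτ, fun z hz => congrFun hτf ⟨z, hz⟩⟩

theorem measurable_sInf_nat {X : Type*} [MeasurableSpace X] {Q : ℕ → X → Prop}
    (hQ : ∀ i, MeasurableSet {x | Q i x}) : Measurable fun x => sInf {i | Q i x} := by
  refine measurable_of_Iic fun n => ?_
  -- The last intersection is where no index qualifies; there `sInf ∅ = 0` lies below every `n`.
  have : (fun x => sInf {i | Q i x}) ⁻¹' Set.Iic n =
      (⋃ i ∈ Set.Iic n, {x | Q i x}) ∪ ⋂ i, {x | Q i x}ᶜ := by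
    ext x
    simp only [Set.mem_preimage, Set.mem_Iic, Set.mem_union, Set.mem_iUnion, Set.mem_iInter,
      Set.mem_compl_iff, exists_prop]
    constructor
    · intro h
      by_cases hne : {i | Q i x}.Nonempty
      · exact Or.inl ⟨_, h, Nat.sInf_mem hne⟩
      · exact Or.inr fun i hi => hne ⟨i, hi⟩
    · rintro (⟨i, hi, hQi⟩ | h)
      · exact (Nat.sInf_le hQi).trans hi
      · have : {i | Q i x} = ∅ := Set.eq_empty_of_forall_notMem h
        simp [this]
  rw [this]
  exact (MeasurableSet.biUnion (Set.to_countable _) fun i _ => hQ i).union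
    (.iInter fun i => (hQ i).compl)

namespace GroupoidOn

variable {X G A : Type*} [MeasurableSpace X] [StandardBorelSpace X] [MeasurableSpace G]
  [StandardBorelSpace G] {μ : Measure X} {𝒢 : GroupoidOn X G} [Group A]

/-- Equivariant Borel sections exist for any homomorphism to a countable group: `σ b x` is chosen such
that `α (σ b x) = b * a`, where `a` is the first element, in some enumeration of the group, with
`b * a ∈ α (r⁻¹ x)`. -/
theorem IsDiscreteMeasured.exists_isEquivariantSystem [Countable A] [MeasurableSpace A]
    [DiscreteMeasurableSpace A] (h𝒢 : 𝒢.IsDiscreteMeasured μ) [Nonempty G]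
    {α : G → A} (hα : Measurable α) {W : Set X} (hW : ∀ g, 𝒢.r g ∈ W → 𝒢.s g ∈ W)
    (hαW : ∀ g h, 𝒢.s g = 𝒢.r h → 𝒢.r g ∈ W → α (𝒢.prod g h) = α g * α h)
    {C : ℕ → Set G} (hC : ∀ n, MeasurableSet (C n)) (hi : ∀ n, Set.InjOn 𝒢.s (C n))
    (hCW : ∀ g, 𝒢.s g ∈ W → g ∈ ⋃ n, C n) :
    ∃ σ : A → X → G, (∀ b, Measurable (σ b)) ∧ 𝒢.IsEquivariantSystem W α σ := by
  have hD : ∀ n, MeasurableSet (𝒢.inv ⁻¹' C n) := fun n => h𝒢.measurable_inv (hC n)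
  have hDi : ∀ n, Set.InjOn 𝒢.r (𝒢.inv ⁻¹' C n) := fun n g hg h hh hgh => by
    rw [← inv_inv (𝒢 := 𝒢) g, ← inv_inv (𝒢 := 𝒢) h,
      hi n hg hh (by rw [𝒢.s_inv, 𝒢.s_inv, hgh])]
  choose τ hτm hτ using fun n => exists_measurable_leftInvOn h𝒢.measurable_r (hD n) (hDi n)
  have hcov : ∀ g, 𝒢.r g ∈ W → ∃ n, τ n (𝒢.r g) = g := fun g hg => by
    obtain ⟨n, hn⟩ := Set.mem_iUnion.1 (hCW (𝒢.inv g) (by rwa [𝒢.s_inv]))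
    exact ⟨n, hτ n hn⟩
  obtain ⟨e, he⟩ := exists_surjective_nat A
  -- The condition `r (τ n x) = x` discards points outside the image of the `n`-th section, where `τ
  -- n` takes arbitrary values.
  let V : A → ℕ → ℕ → X → Prop := fun b i n x => 𝒢.r (τ n x) = x ∧ α (τ n x) = b * e i
  have hV : ∀ b i n, MeasurableSet {x | V b i n x} := fun b i n =>
    (measurableSet_eq_fun (h𝒢.measurable_r.comp (hτm n)) measurable_id).inter
      (measurableSet_eq_fun (hα.comp (hτm n)) measurable_const)
  let Q : A → ℕ → X → Prop := fun b i x => ∃ n, V b i n x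
  have hQ : ∀ b i, MeasurableSet {x | Q b i x} := fun b i => by
    have : {x | Q b i x} = ⋃ n, {x | V b i n x} := by ext; simp [Q]
    rw [this]
    exact .iUnion (hV b i)
  let I : A → X → ℕ := fun b x => sInf {i | Q b i x}
  have hI : ∀ b, Measurable (I b) := fun b => measurable_sInf_nat (hQ b)
  let N : A → X → ℕ := fun b x => sInf {n | V b (I b x) n x}
  have hN : ∀ b, Measurable (N b) := fun b => by
    refine measurable_sInf_nat fun n => ?_
    have : {x | V b (I b x) n x} = ⋃ i, (I b ⁻¹' {i}) ∩ {x | V b i n x} := by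
      ext x; simp
    rw [this]
    exact .iUnion fun i => (hI b (measurableSet_singleton i)).inter (hV b i n)
  have hQiff : ∀ b i, ∀ x ∈ W, (Q b i x ↔ ∃ h, 𝒢.r h = x ∧ α h = b * e i) := by
    intro b i x hx
    constructor
    · rintro ⟨n, hn⟩
      exact ⟨_, hn⟩
    · rintro ⟨h, rfl, hh⟩
      obtain ⟨n, hn⟩ := hcov h hx
      exact ⟨n, by rw [hn], by rw [hn, hh]⟩
  have hmem : ∀ b, ∀ x ∈ W, V b (I b x) (N b x) x := by
    intro b x hx
    have hne : {i | Q b i x}.Nonempty := by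
      obtain ⟨i, hi⟩ := he (b⁻¹ * α (𝒢.unit x))
      exact ⟨i, (hQiff b i x hx).2 ⟨_, 𝒢.r_unit x, by rw [hi, mul_inv_cancel_left]⟩⟩
    exact Nat.sInf_mem (s := {n | V b (I b x) n x}) (Nat.sInf_mem hne)
  refine ⟨fun b x => τ (N b x) x, fun b => ?_, hW, hαW, fun b x hx => (hmem b x hx).1, ?_⟩
  · have : Measurable fun p : ℕ × X => τ p.1 p.2 := measurable_from_prod_countable_right hτm
    exact this.comp ((hN b).prodMk measurable_id)
  · intro b g hg
    rw [(hmem _ _ hg).2, (hmem _ _ (hW g hg)).2, ← _root_.mul_assoc]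
    -- Left multiplication by `g` and by its inverse matches the arrows into `s g` with those into
    -- `r g`, so both infima are over the same index set.
    have : I (α g * b) (𝒢.r g) = I b (𝒢.s g) := by
      change sInf _ = sInf _
      congr 1
      ext i
      refine (hQiff _ _ _ hg).trans (Iff.trans ?_ (hQiff _ _ _ (hW g hg)).symm)
      have hg' : 𝒢.r (𝒢.inv g) ∈ W := by rw [𝒢.r_inv]; exact hW g hg
      constructor
      · rintro ⟨h, hr, hh⟩
        have e' : 𝒢.s (𝒢.inv g) = 𝒢.r h := by rw [𝒢.s_inv, hr]
        refine ⟨𝒢.prod (𝒢.inv g) h, by rw [r_prod e', 𝒢.r_inv], ?_⟩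
        have h2 := hαW g (𝒢.prod (𝒢.inv g) h) (by rw [r_prod e', 𝒢.r_inv]) hg
        rw [prod_inv_cancel_left hr.symm, hh, _root_.mul_assoc] at h2
        exact (mul_left_cancel h2).symm
      · rintro ⟨h, hr, hh⟩
        exact ⟨𝒢.prod g h, r_prod hr.symm, by rw [hαW g h hr.symm hg, hh, _root_.mul_assoc]⟩
    rw [this]

/-! ### The `c₀` condition -/

/-- The function induced from a `c₀`-function on the kernel is a `c₀`-function. -/
theorem IsEquivariantSystem.isCZero_induced [IsFiniteMeasure μ] (h𝒢 : 𝒢.IsDiscreteMeasured μ)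
    {α : G → A} {W : Set X} {σ : A → X → G} (H : 𝒢.IsEquivariantSystem W α σ)
    (hσ : ∀ b, Measurable (σ b)) (hW : ∀ᵐ x ∂μ, x ∈ W)
    {C : ℕ → Set G} (hC : ∀ n, MeasurableSet (C n)) (hi : ∀ n, Set.InjOn 𝒢.s (C n))
    (hCW : ∀ g, 𝒢.s g ∈ W → g ∈ ⋃ n, C n) (F : Finset A) {ψ : G → ℂ}
    (hψ : ∀ δ : ℝ, 0 < δ → ∀ ε : ℝ, 0 < ε → ∃ Y : Set X, MeasurableSet Y ∧
      μ Yᶜ < ENNReal.ofReal δ ∧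
      ∀ᵐ x ∂μ, x ∈ Y → {g : G | α g = 1 ∧ 𝒢.s g = x ∧ 𝒢.r g ∈ Y ∧ ε < ‖ψ g‖}.Finite) :
    𝒢.IsCZero μ (𝒢.induced α σ F ψ) := by
  intro δ hδ ε hε
  have hτ : ∀ b, Measurable fun x => 𝒢.s (σ b x) := fun b => h𝒢.measurable_s.comp (hσ b)
  -- `ν` measures how often the sections lead into a given set. As `x` and `s (σ b x)` are in one
  -- orbit, quasi-invariance gives `ν ≪ μ`, so a set of small `μ`-measure has small preimages under
  -- all `x ↦ s (σ b x)` with `b ∈ F`.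
  let ν : Measure X := ∑ b ∈ F, μ.map fun x => 𝒢.s (σ b x)
  have hν : ν ≪ μ := by
    refine Measure.AbsolutelyContinuous.mk fun s hs h0 => ?_
    rw [Measure.finsetSum_apply]
    refine Finset.sum_eq_zero fun b _ => ?_
    rw [Measure.map_apply (hτ b) hs, measure_eq_zero_iff_ae_notMem]
    filter_upwards [h𝒢.ae_forall_s (measure_eq_zero_iff_ae_notMem.1 h0), hW] with x hx hxW
    exact hx _ (H.r_section b x hxW)
  have hδ2 : ENNReal.ofReal (δ / 2) ≠ 0 := by simpa using hδ
  obtain ⟨η, hη, hην⟩ := exists_pos_setLIntegral_lt_of_measure_lt (μ := μ) (f := ν.rnDeriv μ)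
    (Measure.lintegral_rnDeriv_lt_top ν μ).ne hδ2
  -- `η` may be infinite, whereas the `c₀` condition takes a real number.
  have hη' : min η 1 ≠ ⊤ := ne_top_of_le_ne_top ENNReal.one_ne_top (min_le_right _ _)
  obtain ⟨Y', hY'm, hY'μ, hY'⟩ := hψ (min η 1).toReal
    (ENNReal.toReal_pos (by simpa using hη.ne') hη') ε hε
  have hνY' : ν Y'ᶜ < ENNReal.ofReal (δ / 2) := by
    rw [← Measure.setLIntegral_rnDeriv hν]
    refine hην _ (hY'μ.trans_le ?_)
    rw [ENNReal.ofReal_toReal hη']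
    exact min_le_left _ _
  -- On `D N` the source map is finite-to-one. For large `N` the sections `σ b` with `b ∈ F` take
  -- values in `D N` outside a small set.
  let D : ℕ → Set G := fun N => ⋃ n ∈ Set.Iio N, C n
  have hD : ∀ N, MeasurableSet (D N) := fun N =>
    .biUnion (Set.to_countable _) fun n _ => hC n
  have hDmono : Monotone D := fun M N hMN =>
    Set.biUnion_subset_biUnion_left (Set.Iio_subset_Iio hMN)
  let V : ℕ → Set X := fun N => ⋃ b ∈ F, (σ b ⁻¹' D N)ᶜ
  have hV : ∀ N, MeasurableSet (V N) := fun N =>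
    Finset.measurableSet_biUnion _ fun b _ => (hσ b (hD N)).compl
  have hV0 : Tendsto (fun N => μ (V N)) atTop (𝓝 0) := by
    have hanti : Antitone V := fun M N hMN => Set.iUnion₂_mono fun b _ =>
      Set.compl_subset_compl.2 (Set.preimage_mono (hDmono hMN))
    have h := tendsto_measure_iInter_atTop (μ := μ) (fun N => (hV N).nullMeasurableSet) hanti
      ⟨0, measure_ne_top _ _⟩
    have h0 : μ (⋂ N, V N) = 0 := by
      rw [measure_eq_zero_iff_ae_notMem]
      filter_upwards [hW] with x hx hxV
      have : ∀ b, ∃ n, σ b x ∈ C n := fun b =>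
        Set.mem_iUnion.1 (hCW _ (H.s_mem _ (by rwa [H.r_section b x hx])))
      choose n hn using this
      obtain ⟨b, hb, hbV⟩ := Set.mem_iUnion₂.1 (Set.mem_iInter.1 hxV (F.sup n + 1))
      exact hbV (Set.mem_biUnion (Nat.lt_succ_of_le (Finset.le_sup hb)) (hn b))
    rwa [h0] at h
  obtain ⟨N, hN⟩ := (hV0.eventually (gt_mem_nhds (pos_iff_ne_zero.2 hδ2))).exists
  let Y : Set X := ⋂ b ∈ F, σ b ⁻¹' D N ∩ (fun x => 𝒢.s (σ b x)) ⁻¹' Y'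
  have hY : MeasurableSet Y :=
    Finset.measurableSet_biInter _ fun b _ => (hσ b (hD N)).inter (hτ b hY'm)
  refine ⟨Y, hY.nullMeasurableSet, ?_, ?_⟩
  · have hsub : Yᶜ ⊆ V N ∪ ⋃ b ∈ F, (fun x => 𝒢.s (σ b x)) ⁻¹' Y'ᶜ := by
      intro x hx
      simp only [Y, Set.mem_compl_iff, Set.mem_iInter, not_forall] at hx
      obtain ⟨b, hb, hx⟩ := hx
      by_cases h : σ b x ∈ D N
      · exact Or.inr (Set.mem_biUnion hb fun h' => hx ⟨h, h'⟩)
      · exact Or.inl (Set.mem_biUnion hb h)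
    have hsum : μ (⋃ b ∈ F, (fun x => 𝒢.s (σ b x)) ⁻¹' Y'ᶜ) ≤ ν Y'ᶜ := by
      refine (measure_biUnion_finset_le _ _).trans_eq ?_
      rw [Measure.finsetSum_apply]
      exact Finset.sum_congr rfl fun b _ => (Measure.map_apply (hτ b) hY'm.compl).symm
    calc μ Yᶜ ≤ μ (V N) + ν Y'ᶜ :=
          (measure_mono hsub).trans ((measure_union_le _ _).trans (by gcongr))
      _ < ENNReal.ofReal (δ / 2) + ENNReal.ofReal (δ / 2) := ENNReal.add_lt_add hN hνY'
      _ = ENNReal.ofReal δ := by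
          rw [← ENNReal.ofReal_add (by positivity) (by positivity), add_halves]
  · filter_upwards [h𝒢.ae_forall_s hY', hW] with x hfin hxW hxY
    have hYmem : ∀ {y}, y ∈ Y → ∀ b ∈ F, σ b y ∈ D N ∧ 𝒢.s (σ b y) ∈ Y' := fun hy b hb =>
      Set.mem_iInter₂.1 hy b hb
    have hDfin : ∀ z, {k | k ∈ D N ∧ 𝒢.s k = z}.Finite := by
      intro z
      have : {k | k ∈ D N ∧ 𝒢.s k = z} = ⋃ n ∈ Set.Iio N, {k | k ∈ C n ∧ 𝒢.s k = z} := by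
        ext k
        simp [D, ← exists_and_right, and_left_comm, and_assoc]
      rw [this]
      refine (Set.finite_Iio N).biUnion fun n _ => Set.Subsingleton.finite fun k hk l hl => ?_
      exact hi n hk.1 hl.1 (hk.2.trans hl.2.symm)
    let K : A → Set G := fun b =>
      {h | α h = 1 ∧ 𝒢.s h = 𝒢.s (σ b x) ∧ 𝒢.r h ∈ Y' ∧ ε < ‖ψ h‖}
    have hK : ∀ b ∈ F, (K b).Finite := fun b hb =>
      hfin _ (H.r_section b x hxW) (hYmem hxY b hb).2
    -- Candidates `k h (σ b x)⁻¹` for `g`: finitely many twists `h`, and for each of them finitely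
    -- many `k ∈ D N` with the right source.
    let E : A → Set G := fun b => ⋃ h ∈ K b, (fun k => 𝒢.prod (𝒢.prod k h) (𝒢.inv (σ b x))) ''
      {k | k ∈ D N ∧ 𝒢.s k = 𝒢.r h}
    have hE : (⋃ b ∈ F, E b).Finite :=
      F.finite_toSet.biUnion fun b hb => (hK b hb).biUnion fun h _ => (hDfin _).image _
    refine hE.subset ?_
    rintro g ⟨rfl, hgY, hg⟩
    obtain ⟨b, hb, hab, hlt⟩ := exists_lt_norm_of_lt_norm_induced hε.le hg
    have hgW : 𝒢.r g ∈ W := H.r_mem hxW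
    refine Set.mem_biUnion hb (Set.mem_biUnion (x := 𝒢.twist α σ b g) ?_
      ⟨σ (α g * b) (𝒢.r g), ⟨(hYmem hgY _ hab).1, (H.r_twist b hgW).symm⟩,
        (H.eq_of_twist b hgW).symm⟩)
    exact ⟨H.map_twist b hgW, H.s_twist b hgW, by rw [H.r_twist b hgW]; exact (hYmem hgY _ hab).2, hlt⟩

end GroupoidOn

/-! ### Null-measurable subgroupoids -/

namespace GroupoidOn.MeasurableSubgroupoid

variable {X G : Type*} [MeasurableSpace X] [StandardBorelSpace X] [MeasurableSpace G]
  [StandardBorelSpace G] {μ : Measure X} [IsFiniteMeasure μ] {𝒢 : GroupoidOn X G}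
  (S : 𝒢.MeasurableSubgroupoid μ)

/-- The carrier is only null measurable and need not be standard Borel. The Borel set `T`, equal to
it over almost every unit, makes its fibre counting measures a measurable family. -/
theorem ae_arrowMeasure_iff (h𝒢 : 𝒢.IsDiscreteMeasured μ) {T : Set G} (hT : MeasurableSet T)
    (hST : ∀ᵐ x ∂μ, ∀ g, 𝒢.s g = x → (g ∈ S.carrier ↔ g ∈ T)) {P : S.carrier → Prop} :
    (∀ᵐ g ∂S.toGroupoidOn.arrowMeasure μ, P g) ↔
      ∀ᵐ x ∂μ, ∀ g : S.carrier, 𝒢.s g = x → P g :=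
  ae_fiberCountingMeasure_iff (p := S.toGroupoidOn.s)
    (h𝒢.measurable_s.comp measurable_subtype_coe)
    (aemeasurable_count_restrict_fiber μ h𝒢.measurable_s h𝒢.countable_fiber_s
      Subtype.val_injective rfl hT (by simpa using hST))

/-- A measurable function on a subgroupoid is the restriction of a Borel function on the groupoid, over
almost every unit. -/
theorem exists_measurable_extension (h𝒢 : 𝒢.IsDiscreteMeasured μ) {T : Set G}
    (hT : MeasurableSet T) (hST : ∀ᵐ x ∂μ, ∀ g, 𝒢.s g = x → (g ∈ S.carrier ↔ g ∈ T))
    {φ : S.carrier → ℂ} (hφ : AEMeasurable φ (S.toGroupoidOn.arrowMeasure μ)) :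
    ∃ ψ : G → ℂ, Measurable ψ ∧ ∀ᵐ x ∂μ, ∀ g : S.carrier, 𝒢.s g = x → φ g = ψ g := by
  classical
  obtain ⟨f, hf, hφf⟩ := hφ
  obtain ⟨X₁, hX₁, hX₁m, hST₁⟩ := hST.exists_measurable_mem
  have hR : MeasurableSet (T ∩ 𝒢.s ⁻¹' X₁) := hT.inter (h𝒢.measurable_s hX₁m)
  have hRS : ∀ g ∈ T ∩ 𝒢.s ⁻¹' X₁, g ∈ S.carrier := fun g hg => (hST₁ _ hg.2 g rfl).2 hg.1
  refine ⟨fun g => if hg : g ∈ T ∩ 𝒢.s ⁻¹' X₁ then f ⟨g, hRS g hg⟩ else 0, ?_, ?_⟩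
  · refine Measurable.dite (s := T ∩ 𝒢.s ⁻¹' X₁) (f := fun g => f ⟨g, hRS g g.2⟩)
      (g := fun _ => 0) ?_ measurable_const hR
    exact hf.comp (measurable_subtype_coe.subtype_mk)
  · filter_upwards [(S.ae_arrowMeasure_iff h𝒢 hT hST).1 hφf, hX₁] with x hx hx1 g hg
    have hgR : (g : G) ∈ T ∩ 𝒢.s ⁻¹' X₁ :=
      ⟨(hST₁ x hx1 g hg).1 g.2, by rw [Set.mem_preimage, hg]; exact hx1⟩
    rw [hx g hg, dif_pos hgR]

end GroupoidOn.MeasurableSubgroupoid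

/-! ### Assembly of the proof -/

/-- The Haagerup property passes from the kernel of a homomorphism to an amenable group to the whole
groupoid. The equivariant sections given by `IsDiscreteMeasured.exists_isEquivariantSystem` exist for
every homomorphism, so that neither alternative of `hor` is used. -/
theorem proposition4p12 {X G A : Type*}
    [MeasurableSpace X] [StandardBorelSpace X] (μ : Measure X) [IsProbabilityMeasure μ]
    [MeasurableSpace G] [StandardBorelSpace G]
    (𝒢 : GroupoidOn X G) (h𝒢 : 𝒢.IsDiscreteMeasured μ)
    (S : 𝒢.MeasurableSubgroupoid μ)
    [Group A] [Countable A] [MeasurableSpace A] [DiscreteMeasurableSpace A]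
    (hA : IsAmenableGroup A)
    (α : G → A) (hα : 𝒢.IsHomToGroup μ α)
    (hker : {g : G | α g = 1} =ᵐ[𝒢.arrowMeasure μ] S.carrier)
    (hor : (∀ a b : A, a * b = b * a) ∨ 𝒢.IsClassSurjective μ α)
    (hS : S.toGroupoidOn.HasHaagerupProperty μ) :
    𝒢.HasHaagerupProperty μ := by
  classical
  have hne : Nonempty X := by
    by_contra h
    rw [not_nonempty_iff] at h
    exact IsProbabilityMeasure.ne_zero μ (Measure.eq_zero_of_isEmpty μ)
  have : Nonempty G := hne.map 𝒢.unit
  have := h𝒢.sigmaFinite_arrowMeasure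
  let α' : G → A := hα.aemeasurable.mk α
  have hα'm : Measurable α' := hα.aemeasurable.measurable_mk
  have hαα' : ∀ᵐ x ∂μ, ∀ g, 𝒢.s g = x → α g = α' g :=
    h𝒢.ae_arrowMeasure_iff.1 hα.aemeasurable.ae_eq_mk
  have hmul := h𝒢.ae_composableMeasure_iff.1 hα.map_mul
  have hST : ∀ᵐ x ∂μ, ∀ g, 𝒢.s g = x → (g ∈ S.carrier ↔ g ∈ α' ⁻¹' {1}) := by
    filter_upwards [h𝒢.ae_arrowMeasure_iff.1 hker.mem_iff, hαα'] with x h1 h2 g hg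
    rw [← h1 g hg, Set.mem_preimage, ← h2 g hg]
    rfl
  have hT : MeasurableSet (α' ⁻¹' {1}) := hα'm (measurableSet_singleton 1)
  obtain ⟨φ, hφ, hlim⟩ := hS
  choose ψ hψm hψ using fun n => S.exists_measurable_extension h𝒢 hT hST (hφ n).1
  have hlim' := (S.ae_arrowMeasure_iff h𝒢 hT hST).1 hlim
  obtain ⟨C, hC, hi, -, hcov⟩ := exists_disjoint_sections μ h𝒢.measurable_s h𝒢.countable_fiber_s
  -- From here on, every a.e. hypothesis holds at each point of `W`, and arrows cannot leave `W`.
  obtain ⟨W, hW, hWP, hWinv⟩ := h𝒢.exists_invariant (hαα'.and (hmul.and (hST.and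
    ((ae_all_iff.2 hψ).and (hlim'.and (hcov.and ((ae_all_iff.2 fun n => (hφ n).2.1).and
      (ae_all_iff.2 fun n => (hφ n).2.2.1))))))))
  have hmulW : ∀ g h, 𝒢.s g = 𝒢.r h → 𝒢.r g ∈ W → α' (𝒢.prod g h) = α' g * α' h := by
    intro g h e hg
    have hsg := hWinv g hg
    have hsh := hWinv h (e ▸ hsg)
    have h1 := (hWP _ hsh).2.1 ⟨(g, h), e⟩ rfl
    rw [GroupoidOn.mul_eq_prod, (hWP _ hsh).1 _ (GroupoidOn.s_prod e), (hWP _ hsg).1 g rfl, (hWP _ hsh).1 h rfl] at h1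
    exact h1
  have hmemW : ∀ g, 𝒢.s g ∈ W → (g ∈ S.carrier ↔ α' g = 1) := fun g hg => (hWP _ hg).2.2.1 g rfl
  have hψW : ∀ n, ∀ g : S.carrier, 𝒢.s g ∈ W → φ n g = ψ n g := fun n g hg =>
    (hWP _ hg).2.2.2.1 n g rfl
  obtain ⟨σ, hσ, H⟩ := h𝒢.exists_isEquivariantSystem hα'm hWinv hmulW hC hi
    fun g hg => (hWP _ hg).2.2.2.2.2.1 rfl
  obtain ⟨F, hF, hFlim⟩ := hA.exists_finset_tendsto
  have hWarrow : ∀ᵐ g ∂𝒢.arrowMeasure μ, 𝒢.r g ∈ W := by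
    rw [h𝒢.ae_arrowMeasure_iff (P := fun g => 𝒢.r g ∈ W)]
    exact h𝒢.ae_forall_r hW
  have hψpd : ∀ n, ∀ x ∈ W, ∀ (m : ℕ) (k : Fin m → G), (∀ i, 𝒢.r (k i) = x) →
      (∀ i, α' (k i) = 1) → ∀ c : Fin m → ℂ, 0 ≤ ∑ i, ∑ j, (starRingEnd ℂ) (c i) * c j *
        ψ n (𝒢.prod (𝒢.inv (k i)) (k j)) := by
    intro n x hx m k hk hαk c
    have hsW : ∀ i, 𝒢.s (k i) ∈ W := fun i => hWinv _ ((hk i).symm ▸ hx)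
    have h := (hWP x hx).2.2.2.2.2.2.1 n m
      (fun i => ⟨k i, (hmemW _ (hsW i)).2 (hαk i)⟩) hk c
    convert! h using 5 with i _ j _
    rw [hψW]
    · exact congrArg (ψ n) (GroupoidOn.mul_eq_prod _).symm
    · exact (congrArg (· ∈ W) (𝒢.s_mul (𝒢.inv (k i)) (k j)
        (by rw [𝒢.s_inv, hk, hk]))).mpr (hsW j)
  have hψunit : ∀ n, ∀ x ∈ W, ψ n (𝒢.unit x) = 1 := by
    intro n x hx
    have h := (hWP x hx).2.2.2.2.2.2.2 n
    rwa [hψW n _ (show 𝒢.s (𝒢.unit x) ∈ W by rwa [𝒢.s_unit])] at h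
  have hψc0 : ∀ n, ∀ δ : ℝ, 0 < δ → ∀ ε : ℝ, 0 < ε → ∃ Y : Set X, MeasurableSet Y ∧
      μ Yᶜ < ENNReal.ofReal δ ∧ ∀ᵐ x ∂μ, x ∈ Y →
        {g : G | α' g = 1 ∧ 𝒢.s g = x ∧ 𝒢.r g ∈ Y ∧ ε < ‖ψ n g‖}.Finite := by
    intro n δ hδ ε hε
    obtain ⟨Y, hYm, hYμ, hY⟩ := (hφ n).2.2.2 δ hδ ε hε
    obtain ⟨Y', hY'Y, hY'm, hY'ae⟩ := hYm.exists_measurable_subset_ae_eq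
    refine ⟨Y', hY'm, by rwa [measure_congr hY'ae.compl], ?_⟩
    filter_upwards [hY, hW] with x hx hxW hxY
    refine ((hx (hY'Y hxY)).image Subtype.val).subset ?_
    rintro g ⟨hg1, rfl, hgY, hgε⟩
    refine ⟨⟨g, (hmemW g hxW).2 hg1⟩, ⟨rfl, hY'Y hgY, ?_⟩, rfl⟩
    rwa [hψW n _ hxW]
  have hψlim : ∀ g, 𝒢.r g ∈ W → ∀ b, Tendsto (fun n => ψ n (𝒢.twist α' σ b g)) atTop (𝓝 1) := by
    intro g hg b
    have hs : 𝒢.s (𝒢.twist α' σ b g) ∈ W := by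
      rw [H.s_twist b hg]
      exact hWinv _ (by rw [H.r_section b _ (hWinv g hg)]; exact hWinv g hg)
    have h := (hWP _ hs).2.2.2.2.1 ⟨_, (hmemW _ hs).2 (H.map_twist b hg)⟩ rfl
    exact h.congr fun n => hψW n _ hs
  -- For fixed `k` the limit in `n` is the Følner proportion of `F k`, which tends to 1 in `k`.
  obtain ⟨n, hn⟩ := exists_tendsto_diagonal (𝒢.arrowMeasure μ)
    (f := fun k n => 𝒢.induced α' σ (F k) (ψ n))
    (fun k n => h𝒢.measurable_induced hα'm hσ (F k) (hψm n))
    (fun k => hWarrow.mono fun g hg => GroupoidOn.tendsto_induced (hψlim g hg))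
    (.of_forall fun g => hFlim (α' g))
  refine ⟨fun k => 𝒢.induced α' σ (F k) (ψ (n k)), fun k => ⟨?_, ?_, ?_, ?_⟩, hn⟩
  · exact (h𝒢.measurable_induced hα'm hσ (F k) (hψm _)).aemeasurable
  · filter_upwards [hW] with x hx m g hg c
    simpa only [GroupoidOn.mul_eq_prod] using H.induced_posDef (hψpd _) hx hg c
  · filter_upwards [hW] with x hx using H.induced_unit (hF k) (hψunit _) hx
  · exact H.isCZero_induced h𝒢 hσ hW hC hi (fun g hg => (hWP _ hg).2.2.2.2.2.1 rfl) (F k) (hψc0 _)
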